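/- Let $M$ be a (finite-dimensional, Hausdorff, smooth) manifold with a smooth torsion-free affine connection $\nabla$ such that, for every $x\in M$, the exponential map $\exp_x$ is defined on all of $T_xM$ and maps $T_xM$ onto $M$. Let $C\subseteq M$ be open and geodesically convex (every geodesic $\gamma:[a,b]\to M$ with $\gamma(a),\gamma(b)\in C$ stays in $C$). For smooth $f:C\to\mathbb R$ let $Df$ be its differential, $Hf=\nabla Df$ its Hessian, and $\nabla_v Hf$ the covariant derivative of the Hessian. For $\sigma\ge 0$, $f$ is $\sigma$-self-concordant ($\sigma$-SC) if it is convex along geodesics of $C$, its epigraph $\{(x,y)\in C\times\mathbb R: y\ge f(x)\}$ is closed in $M\times\mathbb R$, $Hf_x$ is positive definite for all $x\in C$, and $$|(\nabla_v Hf)(u,u)|\le 2\sigma\,Hf_x(v,v)^{1/2}\,Hf_x(u,u)\qquad (x\in C,\ u,v\in T_xM).$$ The Newton direction at $x\in C$ is the vector $\bar u\in T_xM$ with $Df_x(\cdot)+Hf_x(\bar u,\cdot)=0$, the Newton decrement is $\lambda_f(x)=Hf_x(\bar u,\bar u)^{1/2}$, and the Newton update is $x^+=\exp_x(\bar u)$.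 **Theorem.** Let $f$ be $\sigma$-SC on $C$ and let $x\in C$. (1) If $\lambda_f(x)<1/\sigma$ (that is, $\sigma\lambda_f(x)<1$; no condition if $\sigma=0$), then $x^+\in C$ and $$\lambda_f(x^+)\le\frac{\sigma\lambda_f(x)^2}{(1-\sigma\lambda_f(x))^2}.$$ (2) In particular, if $\lambda_f(x)<(3-\sqrt5)/(2\sigma)$ (that is, $\sigma\lambda_f(x)<(3-\sqrt5)/2$), then the Newton iteration $x_0=x$, $x_{k+1}=x_k^+$ converges quadratically: $x_k\in C$ for all $k$, $$\lambda_f(x_{k+1})\le\frac{\sigma}{(1-\sigma\lambda_f(x))^2}\,\lambda_f(x_k)^2\quad(k\ge 0),\qquad \lambda_f(x_k)\to 0,$$ and $x_k$ converges to a point of $C$ which is the unique minimizer of $f$ on $C$. -/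

import Mathlib

open Set Filter Topology
open scoped Manifold ContDiff

noncomputable section

namespace SCManifold

variable {E : Type*} [NormedAddCommGroup E] [NormedSpace ℝ E]
  {M : Type*} [TopologicalSpace M] [ChartedSpace E M] [IsManifold 𝓘(ℝ, E) 1 M]

/-! ### Covariant derivatives of covariant tensor fields

Throughout, `cov Y x u` is the covariant derivative `(∇_u Y)(x)`, and `FiberBundle.extend E v` is a
vector field on `M` that is smooth near the base point of `v` and takes the value `v` there. By
tensoriality the two formulas below do not depend on which extension is used. -/

/-- The covariant derivative of a `(0,1)`-tensor field `α` at `x` in the direction `u`: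
`(∇_u α)(v) = u (α(Y)) - α(∇_u Y)`, where `Y` extends `v`. -/
def nablaOne (cov : CovariantDerivative 𝓘(ℝ, E) E (TangentSpace 𝓘(ℝ, E) : M → Type _))
    (α : (x : M) → TangentSpace 𝓘(ℝ, E) x → ℝ) (x : M) (u v : TangentSpace 𝓘(ℝ, E) x) : ℝ :=
  mvfderiv 𝓘(ℝ, E) (fun y : M => α y (FiberBundle.extend E v y)) x u
    - α x (cov (FiberBundle.extend E v) x u)

/-- The covariant derivative of a `(0,2)`-tensor field `G` at `x` in the direction `w`:
`(∇_w G)(u, v) = w (G(Y, Z)) - G(∇_w Y, Z) - G(Y, ∇_w Z)`, where `Y`, `Z` extend `u`, `v`. -/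
def nablaTwo (cov : CovariantDerivative 𝓘(ℝ, E) E (TangentSpace 𝓘(ℝ, E) : M → Type _))
    (G : (x : M) → TangentSpace 𝓘(ℝ, E) x → TangentSpace 𝓘(ℝ, E) x → ℝ) (x : M)
    (w u v : TangentSpace 𝓘(ℝ, E) x) : ℝ :=
  mvfderiv 𝓘(ℝ, E)
      (fun y : M => G y (FiberBundle.extend E u y) (FiberBundle.extend E v y)) x w
    - G x (cov (FiberBundle.extend E u) x w) v
    - G x u (cov (FiberBundle.extend E v) x w)

/-- The differential `Df_x(u)`. -/
def differential (f : M → ℝ) (x : M) (u : TangentSpace 𝓘(ℝ, E) x) : ℝ :=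
  mvfderiv 𝓘(ℝ, E) f x u

/-- The Hessian `Hf_x(u, v) = (∇_u Df)(v)`. -/
def hessian (cov : CovariantDerivative 𝓘(ℝ, E) E (TangentSpace 𝓘(ℝ, E) : M → Type _))
    (f : M → ℝ) (x : M) (u v : TangentSpace 𝓘(ℝ, E) x) : ℝ :=
  nablaOne cov (differential f) x u v

/-- The covariant derivative of the Hessian, `(∇_w Hf)_x(u, v)`. -/
def nablaHessian (cov : CovariantDerivative 𝓘(ℝ, E) E (TangentSpace 𝓘(ℝ, E) : M → Type _))
    (f : M → ℝ) (x : M) (w u v : TangentSpace 𝓘(ℝ, E) x) : ℝ :=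
  nablaTwo cov (hessian cov f) x w u v

/-! ### Geodesics and the exponential map -/

/-- The velocity `γ̇(t)` of a curve `γ` defined on an interval `s` (one-sided at end points
belonging to `s`). -/
def velocity (γ : ℝ → M) (s : Set ℝ) (t : ℝ) : TangentSpace 𝓘(ℝ, E) (γ t) :=
  mfderivWithin 𝓘(ℝ, ℝ) 𝓘(ℝ, E) γ s t (1 : ℝ)

/-- The covariant derivative at `t` of a vector field `V` along a curve `γ : s → M`. If
`e₁, …, eₙ` is the local frame of the tangent bundle given by the trivialization at `γ t`, and
`V = ∑ vᵢ eᵢ`, this is `∑ vᵢ'(t) eᵢ + ∑ vᵢ(t) ∇_{γ̇(t)} eᵢ`; the section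
`FiberBundle.extend E (V t)` is `∑ vᵢ(t) eᵢ`, with constant coefficients. -/
def covDerivAlong (cov : CovariantDerivative 𝓘(ℝ, E) E (TangentSpace 𝓘(ℝ, E) : M → Type _))
    (γ : ℝ → M) (s : Set ℝ) (V : (t : ℝ) → TangentSpace 𝓘(ℝ, E) (γ t)) (t : ℝ) :
    TangentSpace 𝓘(ℝ, E) (γ t) :=
  (trivializationAt E (TangentSpace 𝓘(ℝ, E) : M → Type _) (γ t)).symm (γ t)
      (derivWithin (fun r : ℝ =>
        ((trivializationAt E (TangentSpace 𝓘(ℝ, E) : M → Type _) (γ t))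
          (⟨γ r, V r⟩ : TangentBundle 𝓘(ℝ, E) M)).2) s t)
    + cov (FiberBundle.extend E (V t)) (γ t) (velocity γ s t)

/-- `γ : s → M` is a geodesic: it is smooth and `∇_{γ̇} γ̇ = 0`. Used for nondegenerate intervals
`s`. -/
def IsGeodesicOn (cov : CovariantDerivative 𝓘(ℝ, E) E (TangentSpace 𝓘(ℝ, E) : M → Type _))
    (γ : ℝ → M) (s : Set ℝ) : Prop :=
  ContMDiffOn 𝓘(ℝ, ℝ) 𝓘(ℝ, E) ∞ γ s ∧ ∀ t ∈ s, covDerivAlong cov γ s (velocity γ s) t = 0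

/-- `y` is the end point of a geodesic `γ : [0,1] → M` with `γ(0) = x` and `γ̇(0) = u`, that is,
`exp_x u` is defined and equal to `y`. -/
def IsExp (cov : CovariantDerivative 𝓘(ℝ, E) E (TangentSpace 𝓘(ℝ, E) : M → Type _))
    (x : M) (u : TangentSpace 𝓘(ℝ, E) x) (y : M) : Prop :=
  ∃ γ : ℝ → M, IsGeodesicOn cov γ (Icc 0 1) ∧
    (⟨γ 0, velocity γ (Icc 0 1) 0⟩ : TangentBundle 𝓘(ℝ, E) M) = ⟨x, u⟩ ∧ γ 1 = y

open Classical in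
/-- The exponential map `exp_x u`. The value is unique by uniqueness of geodesics; where no
geodesic `[0,1] → M` with initial data `(x, u)` exists, it is set to `x`. -/
def expMap (cov : CovariantDerivative 𝓘(ℝ, E) E (TangentSpace 𝓘(ℝ, E) : M → Type _))
    (x : M) (u : TangentSpace 𝓘(ℝ, E) x) : M :=
  if h : ∃ y, IsExp cov x u y then h.choose else x

/-- Geodesic convexity of a subset of `M`. -/
def GeodesicallyConvex
    (cov : CovariantDerivative 𝓘(ℝ, E) E (TangentSpace 𝓘(ℝ, E) : M → Type _)) (C : Set M) : Prop :=
  ∀ (γ : ℝ → M) (a b : ℝ), a < b → IsGeodesicOn cov γ (Icc a b) → γ a ∈ C → γ b ∈ C →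
    ∀ t ∈ Icc a b, γ t ∈ C

/-! ### Self-concordance and the Newton method -/

/-- `f` is `σ`-self-concordant on `C` (meant for an open geodesically convex set `C`; only the
values of `f` on `C` matter). -/
structure IsSelfConcordant
    (cov : CovariantDerivative 𝓘(ℝ, E) E (TangentSpace 𝓘(ℝ, E) : M → Type _))
    (C : Set M) (f : M → ℝ) (σ : ℝ) : Prop where
  sigma_nonneg : 0 ≤ σ
  smooth : ContMDiffOn 𝓘(ℝ, E) 𝓘(ℝ, ℝ) ∞ f C
  convex : ∀ (γ : ℝ → M) (a b : ℝ), a < b → IsGeodesicOn cov γ (Icc a b) →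
    (∀ t ∈ Icc a b, γ t ∈ C) → ConvexOn ℝ (Icc a b) (fun t => f (γ t))
  closed_epigraph : IsClosed {p : M × ℝ | p.1 ∈ C ∧ f p.1 ≤ p.2}
  nondegenerate : ∀ x ∈ C, ∀ u : TangentSpace 𝓘(ℝ, E) x, u ≠ 0 → 0 < hessian cov f x u u
  bound : ∀ x ∈ C, ∀ u v : TangentSpace 𝓘(ℝ, E) x,
    |nablaHessian cov f x v u u| ≤ 2 * σ * √(hessian cov f x v v) * hessian cov f x u u

open Classical in
/-- The Newton direction at `x`: the vector `ū` with `Df_x(·) + Hf_x(ū, ·) = 0`, which exists and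
is unique when `Hf_x` is positive definite (and is set to `0` when there is no such vector). -/
def newtonDirection (cov : CovariantDerivative 𝓘(ℝ, E) E (TangentSpace 𝓘(ℝ, E) : M → Type _))
    (f : M → ℝ) (x : M) : TangentSpace 𝓘(ℝ, E) x :=
  if h : ∃ u : TangentSpace 𝓘(ℝ, E) x,
      ∀ v : TangentSpace 𝓘(ℝ, E) x, differential f x v + hessian cov f x u v = 0
  then h.choose else 0

/-- The Newton decrement `λ_f(x) = ‖ū‖_{f,x}`. -/
def newtonDecrement (cov : CovariantDerivative 𝓘(ℝ, E) E (TangentSpace 𝓘(ℝ, E) : M → Type _))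
    (f : M → ℝ) (x : M) : ℝ :=
  √(hessian cov f x (newtonDirection cov f x) (newtonDirection cov f x))

/-- The Newton update `x⁺ = exp_x ū`. -/
def newtonStep (cov : CovariantDerivative 𝓘(ℝ, E) E (TangentSpace 𝓘(ℝ, E) : M → Type _))
    (f : M → ℝ) (x : M) : M :=
  expMap cov x (newtonDirection cov f x)

end SCManifold

end

/-! Everything is reduced to real functions along geodesics. If γ is a geodesic in C and p(t) =
Hf(γ̇,γ̇), then p' = (∇_{γ̇}Hf)(γ̇,γ̇), so self-concordance says |p'| ≤ 2σ p^{3/2}. Formally, 1/√p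
is σ-Lipschitz, and `abs_sqrt_sub_sqrt_le` states this without division. All further estimates rest
on it.

Part (1). Let γ be the Newton geodesic from x and l = λ_f(x) = √p(0). The Lipschitz bound gives
√p(t) ≤ l/(1 - σlt), so f stays bounded along γ. Since the epigraph is closed, γ cannot leave C
(`forall_mem_of_sigma_mul_lt_one`). Now follow the covector ω_t = Df + (1-t) Hf(γ̇,·) along γ. It
vanishes at t = 0 by the Newton equation and equals Df at x⁺ when t = 1. Its covariant derivative is
(1-t)(∇_{γ̇}Hf)(γ̇,·), because ∇_{γ̇}Df = Hf(γ̇,·) cancels the derivative of the factor 1-t. With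
w_t representing ω_t through Hf, the squared dual norm G = Hf(w,w) satisfies G' =
2(1-t)(∇_{γ̇}Hf)(γ̇,w) - (∇_{γ̇}Hf)(w,w) (`hasDerivWithinAt_residual_along`). Polarizing the
self-concordance bound turns this into a linear differential inequality for √G, which
`sqrt_le_of_newton_ode` integrates to exactly σl²/(1-σl)². Since √G(1) = λ_f(x⁺), this is the claim.

Part (2). The number (3-√5)/2 is the smaller root of s = (1-s)², so below it σλ/(1-σλ)² < 1. The
decrements therefore decrease geometrically as well as satisfying the quadratic estimate. A
minimizer exists because the sublevel set of f(x) is compact: every y in C is exp_x u with the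
geodesic inside C, integrating the lower bound for p twice bounds u in terms of f(y) - f(x) and
λ_f(x), and exp_x is continuous. The same lower bound at a minimizer z gives f > f(z) elsewhere in
C. Applied backwards from x_k, the lower bound for the derivative shows that x_k = exp_z u_k with
u_k → 0, hence x_k → z.

The rest is infrastructure: coordinate formulas for Hf, ∇Hf and the geodesic equation, and
continuity of exp_x, obtained from Grönwall's inequality in charts of the tangent bundle. -/

noncomputable section

namespace SCManifold

open Bundle

set_option linter.unusedSectionVars false

/-! ### Tangent vectors and vector fields in a chart -/

section Charts

variable {E : Type*} [NormedAddCommGroup E] [NormedSpace ℝ E]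
  {M : Type*} [TopologicalSpace M] [ChartedSpace E M] [IsManifold 𝓘(ℝ, E) ∞ M]

/-- The components of a tangent vector at `y` in the chart at `x₀`. -/
def toChart (x₀ y : M) : TangentSpace 𝓘(ℝ, E) y →L[ℝ] E :=
  (trivializationAt E (TangentSpace 𝓘(ℝ, E) : M → Type _) x₀).continuousLinearMapAt ℝ y

/-- The tangent vector at `y` with given components in the chart at `x₀`. -/
def ofChart (x₀ y : M) : E →L[ℝ] TangentSpace 𝓘(ℝ, E) y :=
  (trivializationAt E (TangentSpace 𝓘(ℝ, E) : M → Type _) x₀).symmL ℝ y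

lemma mem_baseSet {x₀ y : M} (hy : y ∈ (chartAt E x₀).source) :
    y ∈ (trivializationAt E (TangentSpace 𝓘(ℝ, E) : M → Type _) x₀).baseSet := by
  simpa using hy

lemma toChart_ofChart {x₀ y : M} (hy : y ∈ (chartAt E x₀).source) (a : E) :
    toChart x₀ y (ofChart x₀ y a) = a :=
  Trivialization.continuousLinearMapAt_symmL _ (mem_baseSet hy) a

lemma ofChart_toChart {x₀ y : M} (hy : y ∈ (chartAt E x₀).source) (v : TangentSpace 𝓘(ℝ, E) y) :
    ofChart x₀ y (toChart x₀ y v) = v :=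
  Trivialization.symmL_continuousLinearMapAt _ (mem_baseSet hy) v

lemma trivializationAt_snd {x₀ y : M} (hy : y ∈ (chartAt E x₀).source)
    (v : TangentSpace 𝓘(ℝ, E) y) :
    (trivializationAt E (TangentSpace 𝓘(ℝ, E) : M → Type _) x₀
      (⟨y, v⟩ : TangentBundle 𝓘(ℝ, E) M)).2 = toChart x₀ y v := by
  rw [toChart, Trivialization.continuousLinearMapAt_apply,
    Trivialization.coe_linearMapAt_of_mem _ (mem_baseSet hy)]

lemma trivializationAt_symm {x₀ y : M} (hy : y ∈ (chartAt E x₀).source) (a : E) :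
    (trivializationAt E (TangentSpace 𝓘(ℝ, E) : M → Type _) x₀).symm y a = ofChart x₀ y a :=
  (Trivialization.symmL_apply _ (mem_baseSet hy) _).symm

lemma toChart_eq_mfderiv {x₀ y : M} (hy : y ∈ (chartAt E x₀).source) :
    toChart x₀ y = mfderiv 𝓘(ℝ, E) 𝓘(ℝ, E) (extChartAt 𝓘(ℝ, E) x₀) y :=
  TangentBundle.continuousLinearMapAt_trivializationAt hy

lemma extend_eq {x y : M} (hy : y ∈ (chartAt E x).source) (v : TangentSpace 𝓘(ℝ, E) x) :
    FiberBundle.extend E v y = ofChart x y (toChart x x v) := by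
  rw [← trivializationAt_symm hy, FiberBundle.extend, trivializationAt_snd (mem_chart_source E x)]

lemma extChartAt_symm_mem {x₀ : M} {z : E} (hz : z ∈ (extChartAt 𝓘(ℝ, E) x₀).target) :
    (extChartAt 𝓘(ℝ, E) x₀).symm z ∈ (chartAt E x₀).source := by
  simpa using (extChartAt 𝓘(ℝ, E) x₀).map_target hz

lemma extChartAt_mem_target {x₀ y : M} (hy : y ∈ (chartAt E x₀).source) :
    extChartAt 𝓘(ℝ, E) x₀ y ∈ (extChartAt 𝓘(ℝ, E) x₀).target :=
  (extChartAt 𝓘(ℝ, E) x₀).map_source (by simpa using hy)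

lemma extChartAt_left_inv {x₀ y : M} (hy : y ∈ (chartAt E x₀).source) :
    (extChartAt 𝓘(ℝ, E) x₀).symm (extChartAt 𝓘(ℝ, E) x₀ y) = y :=
  (extChartAt 𝓘(ℝ, E) x₀).left_inv (by simpa using hy)

variable {F : Type*} [NormedAddCommGroup F] [NormedSpace ℝ F]

lemma mvfderiv_of_comp_chart {x₀ y : M} (hy : y ∈ (chartAt E x₀).source) {g : M → F} {g' : E → F}
    (hg : g =ᶠ[𝓝 y] fun y' => g' (extChartAt 𝓘(ℝ, E) x₀ y'))
    (hg' : DifferentiableAt ℝ g' (extChartAt 𝓘(ℝ, E) x₀ y)) (u : TangentSpace 𝓘(ℝ, E) y) :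
    mvfderiv 𝓘(ℝ, E) g y u = fderiv ℝ g' (extChartAt 𝓘(ℝ, E) x₀ y) (toChart x₀ y u) := by
  have h1 : HasMFDerivAt 𝓘(ℝ, E) 𝓘(ℝ, E) (extChartAt 𝓘(ℝ, E) x₀) y (toChart x₀ y) := by
    rw [toChart_eq_mfderiv hy]
    exact (mdifferentiableAt_extChartAt hy).hasMFDerivAt
  have h2 := (hg'.hasFDerivAt.hasMFDerivAt.comp y h1).congr_of_eventuallyEq hg
  rw [mvfderiv, h2.mfderiv]
  rfl

lemma differentiableAt_comp_chart_symm {x₀ y : M} (hy : y ∈ (chartAt E x₀).source) {g : M → F}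
    (hg : MDifferentiableAt 𝓘(ℝ, E) 𝓘(ℝ, F) g y) :
    DifferentiableAt ℝ (fun z => g ((extChartAt 𝓘(ℝ, E) x₀).symm z))
      (extChartAt 𝓘(ℝ, E) x₀ y) := by
  rw [← mdifferentiableAt_iff_differentiableAt]
  have h := mdifferentiableWithinAt_extChartAt_symm (I := 𝓘(ℝ, E)) (extChartAt_mem_target hy)
  simp only [modelWithCornersSelf_coe, range_id, mdifferentiableWithinAt_univ] at h
  rw [← extChartAt_left_inv hy] at hg
  exact hg.comp _ h

lemma mdifferentiableAt_vectorField_iff {x₀ y : M} (hy : y ∈ (chartAt E x₀).source)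
    (X : (x : M) → TangentSpace 𝓘(ℝ, E) x) :
    MDifferentiableAt 𝓘(ℝ, E) 𝓘(ℝ, E).tangent (fun x => (⟨x, X x⟩ : TangentBundle 𝓘(ℝ, E) M)) y ↔
      MDifferentiableAt 𝓘(ℝ, E) 𝓘(ℝ, E) (fun x => toChart x₀ x (X x)) y := by
  have h := (trivializationAt E (TangentSpace 𝓘(ℝ, E) : M → Type _)
    x₀).mdifferentiableAt_section_iff 𝓘(ℝ, E) X (mem_baseSet hy)
  refine h.trans (Filter.EventuallyEq.mdifferentiableAt_iff ?_)
  filter_upwards [(chartAt E x₀).open_source.mem_nhds hy] with x hx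
  exact trivializationAt_snd hx _

lemma contMDiffAt_vectorField_iff {x₀ y : M} (hy : y ∈ (chartAt E x₀).source)
    (X : (x : M) → TangentSpace 𝓘(ℝ, E) x) :
    ContMDiffAt 𝓘(ℝ, E) 𝓘(ℝ, E).tangent ∞ (fun x => (⟨x, X x⟩ : TangentBundle 𝓘(ℝ, E) M)) y ↔
      ContMDiffAt 𝓘(ℝ, E) 𝓘(ℝ, E) ∞ (fun x => toChart x₀ x (X x)) y := by
  have : IsManifold 𝓘(ℝ, E) (∞ + 1) M := ‹IsManifold 𝓘(ℝ, E) ∞ M›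
  have : ContMDiffVectorBundle ∞ E (TangentSpace 𝓘(ℝ, E) : M → Type _) 𝓘(ℝ, E) := inferInstance
  have h := (trivializationAt E (TangentSpace 𝓘(ℝ, E) : M → Type _)
    x₀).contMDiffAt_section_iff (n := ∞) (IB := 𝓘(ℝ, E)) (s := X) (mem_baseSet hy)
  refine h.trans (Filter.EventuallyEq.contMDiffAt_iff ?_)
  filter_upwards [(chartAt E x₀).open_source.mem_nhds hy] with x hx
  exact trivializationAt_snd hx _

end Charts

/-! ### Christoffel symbols: smoothness and symmetry -/

section Christoffel

variable {E : Type*} [NormedAddCommGroup E] [NormedSpace ℝ E]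
  {M : Type*} [TopologicalSpace M] [ChartedSpace E M] [IsManifold 𝓘(ℝ, E) ∞ M]

lemma mdifferentiableAt_ofChart {x₀ y : M} (hy : y ∈ (chartAt E x₀).source) (a : E) :
    MDifferentiableAt 𝓘(ℝ, E) 𝓘(ℝ, E).tangent
      (fun x => (⟨x, ofChart x₀ x a⟩ : TangentBundle 𝓘(ℝ, E) M)) y := by
  rw [mdifferentiableAt_vectorField_iff hy]
  refine (mdifferentiableAt_const (c := a)).congr_of_eventuallyEq ?_
  filter_upwards [(chartAt E x₀).open_source.mem_nhds hy] with x hx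
  exact toChart_ofChart hx a

lemma contMDiffAt_ofChart {x₀ y : M} (hy : y ∈ (chartAt E x₀).source) (a : E) :
    ContMDiffAt 𝓘(ℝ, E) 𝓘(ℝ, E).tangent ∞
      (fun x => (⟨x, ofChart x₀ x a⟩ : TangentBundle 𝓘(ℝ, E) M)) y := by
  rw [contMDiffAt_vectorField_iff hy]
  refine (contMDiffAt_const (c := a)).congr_of_eventuallyEq ?_
  filter_upwards [(chartAt E x₀).open_source.mem_nhds hy] with x hx
  exact toChart_ofChart hx a

/-- The connection on the domain of the chart at `x₀` for which the coordinate fields are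
parallel. -/
def flatConnection (x₀ : M) (X : (x : M) → TangentSpace 𝓘(ℝ, E) x) (y : M) :
    TangentSpace 𝓘(ℝ, E) y →L[ℝ] TangentSpace 𝓘(ℝ, E) y :=
  (ofChart x₀ y).comp (mvfderiv 𝓘(ℝ, E) (fun x => toChart x₀ x (X x)) y)

lemma isCovariantDerivativeOn_flatConnection (x₀ : M) :
    IsCovariantDerivativeOn E (flatConnection (E := E) x₀) (chartAt E x₀).source where
  add {X Y y} hX hY hy := by
    rw [mdifferentiableAt_vectorField_iff hy] at hX hY
    have h : (fun x => toChart x₀ x ((X + Y) x)) =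
        (fun x => toChart x₀ x (X x)) + fun x => toChart x₀ x (Y x) := by
      ext x; simp
    rw [flatConnection, h, mvfderiv_add hX hY, ContinuousLinearMap.comp_add]
    rfl
  leibniz {X g y} hX hg hy := by
    rw [mdifferentiableAt_vectorField_iff hy] at hX
    have h : (fun x => toChart x₀ x ((g • X) x)) = g • fun x => toChart x₀ x (X x) := by
      ext x; simp
    rw [flatConnection, h, mvfderiv_smul hg hX]
    ext u
    simp [flatConnection, ofChart_toChart hy]

variable [FiniteDimensional ℝ E]
  (cov : CovariantDerivative 𝓘(ℝ, E) E (TangentSpace 𝓘(ℝ, E) : M → Type _))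

/-- The Christoffel symbols of the connection in the chart at `x₀`: `christoffel cov x₀ z a b` has
the components of `∇_b a`, where `a` and `b` are extended with constant components. -/
def christoffel (x₀ : M) (z : E) : E →L[ℝ] E →L[ℝ] E :=
  (LinearMap.mk₂ ℝ (fun a b : E => toChart x₀ ((extChartAt 𝓘(ℝ, E) x₀).symm z)
    (IsCovariantDerivativeOn.difference (cov.isCovariantDerivativeOn (s := (chartAt E x₀).source))
      (isCovariantDerivativeOn_flatConnection x₀) ((extChartAt 𝓘(ℝ, E) x₀).symm z)
      (ofChart x₀ _ a) (ofChart x₀ _ b)))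
      (fun _ _ _ => by rw [map_add, map_add, _root_.add_apply, map_add])
      (fun _ _ _ => by rw [map_smul, map_smul, _root_.smul_apply, map_smul])
      (fun _ _ _ => by rw [map_add, map_add, map_add])
      (fun _ _ _ => by rw [map_smul, map_smul, map_smul])).toContinuousBilinearMap

lemma toChart_cov {x₀ y : M} (hy : y ∈ (chartAt E x₀).source)
    {X : (x : M) → TangentSpace 𝓘(ℝ, E) x}
    (hX : MDifferentiableAt 𝓘(ℝ, E) 𝓘(ℝ, E).tangent
      (fun x => (⟨x, X x⟩ : TangentBundle 𝓘(ℝ, E) M)) y) (u : TangentSpace 𝓘(ℝ, E) y) :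
    toChart x₀ y (cov X y u) = mvfderiv 𝓘(ℝ, E) (fun x => toChart x₀ x (X x)) y u +
      christoffel cov x₀ (extChartAt 𝓘(ℝ, E) x₀ y) (toChart x₀ y (X y)) (toChart x₀ y u) := by
  have h := IsCovariantDerivativeOn.difference_apply
    (cov.isCovariantDerivativeOn (s := (chartAt E x₀).source))
      (isCovariantDerivativeOn_flatConnection x₀) hy hX
  have h2 : christoffel cov x₀ (extChartAt 𝓘(ℝ, E) x₀ y) (toChart x₀ y (X y)) (toChart x₀ y u) =
      toChart x₀ y (IsCovariantDerivativeOn.difference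
        (cov.isCovariantDerivativeOn (s := (chartAt E x₀).source))
      (isCovariantDerivativeOn_flatConnection x₀) y (X y) u) := by
    have h3 : ∀ y', y' = y → toChart x₀ y'
      (IsCovariantDerivativeOn.difference (cov.isCovariantDerivativeOn (s := (chartAt E x₀).source))
      (isCovariantDerivativeOn_flatConnection x₀) y'
      (ofChart x₀ _ (toChart x₀ y (X y))) (ofChart x₀ _ (toChart x₀ y u))) =
      toChart x₀ y (IsCovariantDerivativeOn.difference
        (cov.isCovariantDerivativeOn (s := (chartAt E x₀).source))
      (isCovariantDerivativeOn_flatConnection x₀) y (X y) u) := by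
      rintro _ rfl
      rw [ofChart_toChart hy, ofChart_toChart hy]
    exact h3 _ (extChartAt_left_inv hy)
  rw [h2, h, _root_.sub_apply, map_sub, flatConnection, ContinuousLinearMap.comp_apply,
    toChart_ofChart hy]
  abel

lemma christoffel_apply {x₀ y : M} (hy : y ∈ (chartAt E x₀).source) (a b : E) :
    christoffel cov x₀ (extChartAt 𝓘(ℝ, E) x₀ y) a b =
      toChart x₀ y (cov (fun x => ofChart x₀ x a) y (ofChart x₀ y b)) := by
  rw [toChart_cov cov hy (mdifferentiableAt_ofChart hy a), toChart_ofChart hy, toChart_ofChart hy,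
    mvfderiv_of_comp_chart hy (g' := fun _ => a) _ (by fun_prop)]
  · simp
  · filter_upwards [(chartAt E x₀).open_source.mem_nhds hy] with x hx
    exact toChart_ofChart hx a

variable [T2Space M]

/-- A bump function cuts off the coordinate field. Global fields are needed because the smoothness
and torsion hypotheses on the connection are applied to fields on all of M. -/
lemma exists_global_vectorField {x₀ y : M} (hy : y ∈ (chartAt E x₀).source) (a : E) :
    ∃ X : (x : M) → TangentSpace 𝓘(ℝ, E) x,
      ContMDiff 𝓘(ℝ, E) 𝓘(ℝ, E).tangent ∞ (fun x => (⟨x, X x⟩ : TangentBundle 𝓘(ℝ, E) M)) ∧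
      ∀ᶠ x in 𝓝 y, X x = ofChart x₀ x a := by
  obtain ⟨φ, -, hφ⟩ := (SmoothBumpFunction.nhds_basis_tsupport (I := 𝓘(ℝ, E)) y).mem_iff.1
    ((chartAt E x₀).open_source.mem_nhds hy)
  refine ⟨(φ : M → ℝ) • fun x => ofChart x₀ x a, ?_, ?_⟩
  · exact ContMDiffOn.smul_section_of_tsupport φ.contMDiff.contMDiffOn (chartAt E x₀).open_source
      hφ fun x hx => (contMDiffAt_ofChart hx a).contMDiffWithinAt
  · filter_upwards [φ.eventuallyEq_one] with x hx
    simp [hx]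

lemma cov_congr {X Y : (x : M) → TangentSpace 𝓘(ℝ, E) x} {y : M}
    (hY : MDifferentiableAt 𝓘(ℝ, E) 𝓘(ℝ, E).tangent
      (fun x => (⟨x, Y x⟩ : TangentBundle 𝓘(ℝ, E) M)) y) (h : ∀ᶠ x in 𝓝 y, X x = Y x) :
    cov X y = cov Y y := by
  refine cov.isCovariantDerivativeOnUniv.congr_of_eventuallyEq ?_ hY univ_mem h
  refine hY.congr_of_eventuallyEq ?_
  filter_upwards [h] with x hx
  rw [hx]

lemma contDiffOn_christoffel (hsmooth : CovariantDerivative.ContMDiffCovariantDerivative cov ∞)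
    (x₀ : M) : ContDiffOn ℝ ∞ (christoffel cov x₀) (extChartAt 𝓘(ℝ, E) x₀).target := by
  rw [contDiffOn_clm_apply]
  intro a
  rw [contDiffOn_clm_apply]
  intro b z hz
  have hy := extChartAt_symm_mem hz
  set y := (extChartAt 𝓘(ℝ, E) x₀).symm z with hyz
  obtain ⟨X, hX, hXa⟩ := exists_global_vectorField hy a
  have h1 := hsmooth.contMDiff.contMDiff (σ := X) (contMDiffOn_univ.2 hX)
  have h2 : ContMDiffAt 𝓘(ℝ, E) 𝓘(ℝ, E).tangent ∞
      (fun x => (⟨x, cov X x (ofChart x₀ x b)⟩ : TangentBundle 𝓘(ℝ, E) M)) y :=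
    ContMDiffAt.clm_bundle_apply (h1.contMDiffAt univ_mem) (contMDiffAt_ofChart hy b)
  rw [contMDiffAt_vectorField_iff hy] at h2
  have h3 : ContMDiffAt 𝓘(ℝ, E) 𝓘(ℝ, E) ∞ (extChartAt 𝓘(ℝ, E) x₀).symm z :=
    (contMDiffOn_extChartAt_symm x₀).contMDiffAt ((isOpen_extChartAt_target x₀).mem_nhds hz)
  have h4 := (h2.comp_of_eq h3 hyz.symm).contDiffAt
  refine (h4.congr_of_eventuallyEq ?_).contDiffWithinAt
  have h5 := ((hXa.eventually_nhds).and ((chartAt E x₀).open_source.mem_nhds hy))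
  filter_upwards [h3.continuousAt.eventually h5, (isOpen_extChartAt_target x₀).mem_nhds hz]
    with w hw hw'
  have h6 := christoffel_apply cov hw.2 a b
  rw [(extChartAt 𝓘(ℝ, E) x₀).right_inv hw'] at h6
  rw [h6, Function.comp, cov_congr cov (mdifferentiableAt_ofChart hw.2 a) hw.1]

/-- In the chart the coordinate fields become constant, and constant fields commute. -/
lemma mlieBracket_ofChart (x : M) (a b : E) :
    VectorField.mlieBracket 𝓘(ℝ, E) (fun y => ofChart x y a) (fun y => ofChart x y b) x = 0 := by
  have hc : ∀ a : E, VectorField.mpullbackWithin 𝓘(ℝ, E) 𝓘(ℝ, E) (extChartAt 𝓘(ℝ, E) x).symm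
      (fun y => ofChart x y a) (range 𝓘(ℝ, E)) =ᶠ[𝓝 (extChartAt 𝓘(ℝ, E) x x)] fun _ => a := by
    intro a
    filter_upwards [extChartAt_target_mem_nhds (I := 𝓘(ℝ, E)) x] with z hz
    have h := TangentBundle.symmL_trivializationAt (I := 𝓘(ℝ, E)) (extChartAt_symm_mem hz)
    rw [(extChartAt 𝓘(ℝ, E) x).right_inv hz] at h
    rw [VectorField.mpullbackWithin_apply, ofChart, h]
    have h2 := isInvertible_mfderivWithin_extChartAt_symm hz
    exact h2.inverse_apply_eq.2 rfl
  rw [← VectorField.mlieBracketWithin_univ, VectorField.mlieBracketWithin_apply]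
  have h0 : ∀ (V W : E → E) (z : E), V =ᶠ[𝓝 z] (fun _ => a) → W =ᶠ[𝓝 z] (fun _ => b) →
      VectorField.lieBracketWithin ℝ V W univ z = 0 := by
    intro V W z hV hW
    rw [VectorField.lieBracketWithin_univ, hV.lieBracket_vectorField_eq hW]
    simp [VectorField.lieBracket]
  simp only [preimage_univ, modelWithCornersSelf_coe, range_id, inter_univ] at hc ⊢
  exact (congrArg _ (h0 _ _ _ (hc a) (hc b))).trans (map_zero _)

lemma christoffel_symm
    (htorsion : ∀ (X Y : (x : M) → TangentSpace 𝓘(ℝ, E) x),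
      ContMDiff 𝓘(ℝ, E) 𝓘(ℝ, E).tangent ∞ (fun x => (⟨x, X x⟩ : TangentBundle 𝓘(ℝ, E) M)) →
      ContMDiff 𝓘(ℝ, E) 𝓘(ℝ, E).tangent ∞ (fun x => (⟨x, Y x⟩ : TangentBundle 𝓘(ℝ, E) M)) →
      ∀ x, cov Y x (X x) - cov X x (Y x) = VectorField.mlieBracket 𝓘(ℝ, E) X Y x)
    (x : M) (a b : E) :
    christoffel cov x (extChartAt 𝓘(ℝ, E) x x) a b =
      christoffel cov x (extChartAt 𝓘(ℝ, E) x x) b a := by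
  have hx := mem_chart_source E x
  obtain ⟨X, hX, hXa⟩ := exists_global_vectorField hx a
  obtain ⟨Y, hY, hYb⟩ := exists_global_vectorField hx b
  have h := htorsion X Y hX hY x
  rw [cov_congr cov (mdifferentiableAt_ofChart hx a) hXa,
    cov_congr cov (mdifferentiableAt_ofChart hx b) hYb, hXa.self_of_nhds, hYb.self_of_nhds,
    Filter.EventuallyEq.mlieBracket_vectorField_eq hXa hYb, mlieBracket_ofChart, sub_eq_zero] at h
  rw [christoffel_apply cov hx, christoffel_apply cov hx, h]

end Christoffel

/-! ### Coordinate formulas for the differential, the Hessian and its covariant derivative -/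

section TensorsInCharts

variable {E : Type*} [NormedAddCommGroup E] [NormedSpace ℝ E] [FiniteDimensional ℝ E]
  {M : Type*} [TopologicalSpace M] [ChartedSpace E M] [IsManifold 𝓘(ℝ, E) ∞ M]
  (cov : CovariantDerivative 𝓘(ℝ, E) E (TangentSpace 𝓘(ℝ, E) : M → Type _))

/-- In a chart other than the one at y, the extension of v need not have constant components. `W`
records them, so that the term with its derivative can be cancelled against the product rule in
`nablaOne_eq` and `nablaTwo_eq`; this is tensoriality. -/
lemma toChart_cov_extend {x₀ y : M} (hy : y ∈ (chartAt E x₀).source)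
    (u v : TangentSpace 𝓘(ℝ, E) y) :
    ∃ W : E → E, DifferentiableAt ℝ W (extChartAt 𝓘(ℝ, E) x₀ y) ∧
      (∀ᶠ x in 𝓝 y, toChart x₀ x (FiberBundle.extend E v x) = W (extChartAt 𝓘(ℝ, E) x₀ x)) ∧
      W (extChartAt 𝓘(ℝ, E) x₀ y) = toChart x₀ y v ∧
      toChart x₀ y (cov (FiberBundle.extend E v) y u) =
        fderiv ℝ W (extChartAt 𝓘(ℝ, E) x₀ y) (toChart x₀ y u) +
        christoffel cov x₀ (extChartAt 𝓘(ℝ, E) x₀ y) (toChart x₀ y v) (toChart x₀ y u) := by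
  have hX : MDifferentiableAt 𝓘(ℝ, E) 𝓘(ℝ, E).tangent
      (fun x => (⟨x, FiberBundle.extend E v x⟩ : TangentBundle 𝓘(ℝ, E) M)) y :=
    FiberBundle.mdifferentiableAt_extend ..
  have hX' := (mdifferentiableAt_vectorField_iff hy _).1 hX
  have hd := differentiableAt_comp_chart_symm hy hX'
  set W : E → E := fun z => toChart x₀ ((extChartAt 𝓘(ℝ, E) x₀).symm z)
    (FiberBundle.extend E v ((extChartAt 𝓘(ℝ, E) x₀).symm z))
  have hW : ∀ x ∈ (chartAt E x₀).source,
      toChart x₀ x (FiberBundle.extend E v x) = W (extChartAt 𝓘(ℝ, E) x₀ x) := fun x hx =>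
    (congrArg (fun x => toChart x₀ x (FiberBundle.extend E v x)) (extChartAt_left_inv hx)).symm
  have he : (fun x => toChart x₀ x (FiberBundle.extend E v x)) =ᶠ[𝓝 y]
      fun x => W (extChartAt 𝓘(ℝ, E) x₀ x) := by
    filter_upwards [(chartAt E x₀).open_source.mem_nhds hy] with x hx using hW x hx
  refine ⟨W, hd, he, ?_, ?_⟩
  · rw [← hW y hy, FiberBundle.extend_apply_self]
  · rw [toChart_cov cov hy hX, FiberBundle.extend_apply_self, mvfderiv_of_comp_chart hy he hd]

lemma nablaOne_eq {x₀ y : M} (hy : y ∈ (chartAt E x₀).source)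
    {α : (x : M) → TangentSpace 𝓘(ℝ, E) x → ℝ} {α' : E → E →L[ℝ] ℝ}
    (hα : ∀ᶠ x in 𝓝 y, ∀ v, α x v = α' (extChartAt 𝓘(ℝ, E) x₀ x) (toChart x₀ x v))
    (hα' : DifferentiableAt ℝ α' (extChartAt 𝓘(ℝ, E) x₀ y)) (u v : TangentSpace 𝓘(ℝ, E) y) :
    nablaOne cov α y u v =
      fderiv ℝ α' (extChartAt 𝓘(ℝ, E) x₀ y) (toChart x₀ y u) (toChart x₀ y v) -
      α' (extChartAt 𝓘(ℝ, E) x₀ y)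
        (christoffel cov x₀ (extChartAt 𝓘(ℝ, E) x₀ y) (toChart x₀ y v) (toChart x₀ y u)) := by
  obtain ⟨W, hW, hWe, hWy, hWc⟩ := toChart_cov_extend cov hy u v
  have h1 : (fun x => α x (FiberBundle.extend E v x)) =ᶠ[𝓝 y]
      fun x => (fun z => α' z (W z)) (extChartAt 𝓘(ℝ, E) x₀ x) := by
    filter_upwards [hα, hWe] with x hx hx'
    rw [hx, hx']
  have h2 := (hα'.hasFDerivAt.clm_apply hW.hasFDerivAt)
  rw [nablaOne, mvfderiv_of_comp_chart hy h1 h2.differentiableAt, h2.fderiv, hα.self_of_nhds, hWc,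
    hWy]
  simp

lemma nablaTwo_eq {x₀ y : M} (hy : y ∈ (chartAt E x₀).source)
    {G : (x : M) → TangentSpace 𝓘(ℝ, E) x → TangentSpace 𝓘(ℝ, E) x → ℝ}
    {G' : E → E →L[ℝ] E →L[ℝ] ℝ}
    (hG : ∀ᶠ x in 𝓝 y, ∀ u v,
      G x u v = G' (extChartAt 𝓘(ℝ, E) x₀ x) (toChart x₀ x u) (toChart x₀ x v))
    (hG' : DifferentiableAt ℝ G' (extChartAt 𝓘(ℝ, E) x₀ y)) (w u v : TangentSpace 𝓘(ℝ, E) y) :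
    nablaTwo cov G y w u v =
      fderiv ℝ G' (extChartAt 𝓘(ℝ, E) x₀ y) (toChart x₀ y w) (toChart x₀ y u) (toChart x₀ y v) -
      G' (extChartAt 𝓘(ℝ, E) x₀ y)
        (christoffel cov x₀ (extChartAt 𝓘(ℝ, E) x₀ y) (toChart x₀ y u) (toChart x₀ y w))
        (toChart x₀ y v) -
      G' (extChartAt 𝓘(ℝ, E) x₀ y) (toChart x₀ y u)
        (christoffel cov x₀ (extChartAt 𝓘(ℝ, E) x₀ y) (toChart x₀ y v) (toChart x₀ y w)) := by
  obtain ⟨U, hU, hUe, hUy, hUc⟩ := toChart_cov_extend cov hy w u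
  obtain ⟨V, hV, hVe, hVy, hVc⟩ := toChart_cov_extend cov hy w v
  have h1 : (fun x => G x (FiberBundle.extend E u x) (FiberBundle.extend E v x)) =ᶠ[𝓝 y]
      fun x => (fun z => G' z (U z) (V z)) (extChartAt 𝓘(ℝ, E) x₀ x) := by
    filter_upwards [hG, hUe, hVe] with x hx hx' hx''
    rw [hx, hx', hx'']
  have h2 := (hG'.hasFDerivAt.clm_apply hU.hasFDerivAt).clm_apply hV.hasFDerivAt
  rw [nablaTwo, mvfderiv_of_comp_chart hy h1 h2.differentiableAt, h2.fderiv, hG.self_of_nhds,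
    hG.self_of_nhds, hUc, hVc, hVy, hUy]
  simp
  ring

/-- The function `f` in the chart at `x₀`. -/
def inChart (f : M → ℝ) (x₀ : M) (z : E) : ℝ := f ((extChartAt 𝓘(ℝ, E) x₀).symm z)

/-- The Hessian of `f` in the chart at `x₀`. -/
def chartHessian (f : M → ℝ) (x₀ : M) (z : E) : E →L[ℝ] E →L[ℝ] ℝ :=
  fderiv ℝ (fderiv ℝ (inChart f x₀)) z -
    ((ContinuousLinearMap.compL ℝ E E ℝ (fderiv ℝ (inChart f x₀) z)).comp
      (christoffel cov x₀ z)).flip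

lemma chartHessian_apply (f : M → ℝ) (x₀ : M) (z a b : E) :
    chartHessian cov f x₀ z a b = fderiv ℝ (fderiv ℝ (inChart f x₀)) z a b -
      fderiv ℝ (inChart f x₀) z (christoffel cov x₀ z b a) := rfl

variable {C : Set M} (hC : IsOpen C) {f : M → ℝ}
  (hf : ContMDiffOn 𝓘(ℝ, E) 𝓘(ℝ, ℝ) ∞ f C)
include hC hf

lemma contDiffAt_inChart {x₀ y : M} (hy : y ∈ (chartAt E x₀).source) (hyC : y ∈ C) :
    ContDiffAt ℝ ∞ (inChart f x₀) (extChartAt 𝓘(ℝ, E) x₀ y) := by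
  have hz := extChartAt_mem_target hy
  have h3 : ContMDiffAt 𝓘(ℝ, E) 𝓘(ℝ, E) ∞ (extChartAt 𝓘(ℝ, E) x₀).symm
      (extChartAt 𝓘(ℝ, E) x₀ y) :=
    (contMDiffOn_extChartAt_symm x₀).contMDiffAt ((isOpen_extChartAt_target x₀).mem_nhds hz)
  exact ((hf.contMDiffAt (hC.mem_nhds hyC)).comp_of_eq h3 (extChartAt_left_inv hy)).contDiffAt

lemma differential_eq {x₀ y : M} (hy : y ∈ (chartAt E x₀).source) (hyC : y ∈ C)
    (v : TangentSpace 𝓘(ℝ, E) y) :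
    differential f y v =
      fderiv ℝ (inChart f x₀) (extChartAt 𝓘(ℝ, E) x₀ y) (toChart x₀ y v) := by
  refine mvfderiv_of_comp_chart hy ?_
    ((contDiffAt_inChart hC hf hy hyC).differentiableAt (by simp)) v
  filter_upwards [(chartAt E x₀).open_source.mem_nhds hy] with x hx
  rw [inChart, extChartAt_left_inv hx]

lemma hessian_eq {x₀ y : M} (hy : y ∈ (chartAt E x₀).source) (hyC : y ∈ C)
    (u v : TangentSpace 𝓘(ℝ, E) y) :
    hessian cov f y u v =
      chartHessian cov f x₀ (extChartAt 𝓘(ℝ, E) x₀ y) (toChart x₀ y u) (toChart x₀ y v) := by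
  refine nablaOne_eq cov hy ?_ ?_ u v
  · filter_upwards [(chartAt E x₀).open_source.mem_nhds hy, hC.mem_nhds hyC] with x hx hxC v
    exact differential_eq hC hf hx hxC v
  · exact ((contDiffAt_inChart hC hf hy hyC).fderiv_right (m := 1)
      (WithTop.coe_le_coe.2 le_top)).differentiableAt
      (by simp)

variable [T2Space M] (hsmooth : CovariantDerivative.ContMDiffCovariantDerivative cov ∞)

include hsmooth in
lemma differentiableAt_chartHessian {x₀ y : M} (hy : y ∈ (chartAt E x₀).source) (hyC : y ∈ C) :
    DifferentiableAt ℝ (chartHessian cov f x₀) (extChartAt 𝓘(ℝ, E) x₀ y) := by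
  set Ω := (extChartAt 𝓘(ℝ, E) x₀).target ∩ (extChartAt 𝓘(ℝ, E) x₀).symm ⁻¹' C
  have hΩ : IsOpen Ω := (continuousOn_extChartAt_symm x₀).isOpen_inter_preimage
    (isOpen_extChartAt_target x₀) hC
  have hyΩ : extChartAt 𝓘(ℝ, E) x₀ y ∈ Ω :=
    ⟨extChartAt_mem_target hy, by rwa [mem_preimage, extChartAt_left_inv hy]⟩
  have h0 : ContDiffOn ℝ ∞ (inChart f x₀) Ω := by
    intro z hz
    have h := contDiffAt_inChart hC hf (extChartAt_symm_mem hz.1) hz.2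
    rw [(extChartAt 𝓘(ℝ, E) x₀).right_inv hz.1] at h
    exact h.contDiffWithinAt
  have h1 : ContDiffOn ℝ 2 (fderiv ℝ (inChart f x₀)) Ω :=
    h0.fderiv_of_isOpen hΩ (WithTop.coe_le_coe.2 le_top)
  have h2 : ContDiffOn ℝ 1 (fderiv ℝ (fderiv ℝ (inChart f x₀))) Ω :=
    h1.fderiv_of_isOpen hΩ (by norm_num)
  have h3 : ContDiffOn ℝ 1 (christoffel cov x₀) Ω :=
    ((contDiffOn_christoffel cov hsmooth x₀).mono inter_subset_left).of_le (by simp)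
  have h4 : ContDiffOn ℝ 1 (chartHessian cov f x₀) Ω := by
    rw [contDiffOn_clm_apply]
    intro a
    rw [contDiffOn_clm_apply]
    intro b
    simp only [chartHessian_apply]
    exact ((h2.clm_apply contDiffOn_const).clm_apply contDiffOn_const).sub
      ((h1.of_le one_le_two).clm_apply
        ((h3.clm_apply contDiffOn_const).clm_apply contDiffOn_const))
  exact (h4.contDiffAt (hΩ.mem_nhds hyΩ)).differentiableAt (by simp)

include hsmooth in
lemma nablaHessian_eq {x₀ y : M} (hy : y ∈ (chartAt E x₀).source) (hyC : y ∈ C)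
    (w u v : TangentSpace 𝓘(ℝ, E) y) :
    nablaHessian cov f y w u v =
      fderiv ℝ (chartHessian cov f x₀) (extChartAt 𝓘(ℝ, E) x₀ y) (toChart x₀ y w)
        (toChart x₀ y u) (toChart x₀ y v) -
      chartHessian cov f x₀ (extChartAt 𝓘(ℝ, E) x₀ y)
        (christoffel cov x₀ (extChartAt 𝓘(ℝ, E) x₀ y) (toChart x₀ y u) (toChart x₀ y w))
        (toChart x₀ y v) -
      chartHessian cov f x₀ (extChartAt 𝓘(ℝ, E) x₀ y) (toChart x₀ y u)
        (christoffel cov x₀ (extChartAt 𝓘(ℝ, E) x₀ y) (toChart x₀ y v) (toChart x₀ y w)) := by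
  refine nablaTwo_eq cov hy ?_ (differentiableAt_chartHessian cov hC hf hsmooth hy hyC) w u v
  filter_upwards [(chartAt E x₀).open_source.mem_nhds hy, hC.mem_nhds hyC] with x hx hxC u v
  exact hessian_eq cov hC hf hx hxC u v

variable (htorsion : ∀ (X Y : (x : M) → TangentSpace 𝓘(ℝ, E) x),
      ContMDiff 𝓘(ℝ, E) 𝓘(ℝ, E).tangent ∞ (fun x => (⟨x, X x⟩ : TangentBundle 𝓘(ℝ, E) M)) →
      ContMDiff 𝓘(ℝ, E) 𝓘(ℝ, E).tangent ∞ (fun x => (⟨x, Y x⟩ : TangentBundle 𝓘(ℝ, E) M)) →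
      ∀ x, cov Y x (X x) - cov X x (Y x) = VectorField.mlieBracket 𝓘(ℝ, E) X Y x)
include htorsion

/-- Second derivatives commute, and the correction term is symmetric because the connection is
torsion-free. The chart at y itself is used, since `christoffel_symm` concerns the centre of a
chart; `chartHessian_symm` carries the symmetry to other charts. -/
lemma hessian_symm {y : M} (hyC : y ∈ C) (u v : TangentSpace 𝓘(ℝ, E) y) :
    hessian cov f y u v = hessian cov f y v u := by
  have hy := mem_chart_source E y
  have h := (contDiffAt_inChart hC hf hy hyC).isSymmSndFDerivAt
    (by simpa using (WithTop.coe_le_coe.2 le_top : (2 : ℕ∞ω) ≤ ∞))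
  rw [hessian_eq cov hC hf hy hyC, hessian_eq cov hC hf hy hyC, chartHessian_apply,
    chartHessian_apply, christoffel_symm cov htorsion, h.eq]

lemma chartHessian_symm {x₀ y : M} (hy : y ∈ (chartAt E x₀).source) (hyC : y ∈ C) (a b : E) :
    chartHessian cov f x₀ (extChartAt 𝓘(ℝ, E) x₀ y) a b =
      chartHessian cov f x₀ (extChartAt 𝓘(ℝ, E) x₀ y) b a := by
  have h := hessian_symm cov hC hf htorsion hyC (ofChart x₀ y a) (ofChart x₀ y b)
  rwa [hessian_eq cov hC hf hy hyC, hessian_eq cov hC hf hy hyC, toChart_ofChart hy,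
    toChart_ofChart hy] at h

include hsmooth

lemma fderiv_chartHessian_symm {x₀ y : M} (hy : y ∈ (chartAt E x₀).source) (hyC : y ∈ C)
    (c a b : E) :
    fderiv ℝ (chartHessian cov f x₀) (extChartAt 𝓘(ℝ, E) x₀ y) c a b =
      fderiv ℝ (chartHessian cov f x₀) (extChartAt 𝓘(ℝ, E) x₀ y) c b a := by
  have hd := (differentiableAt_chartHessian cov hC hf hsmooth hy hyC).hasFDerivAt
  have h1 : ∀ a b : E, HasFDerivAt (fun z => chartHessian cov f x₀ z a b)
      (((fderiv ℝ (chartHessian cov f x₀) (extChartAt 𝓘(ℝ, E) x₀ y)).flip a).flip b)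
      (extChartAt 𝓘(ℝ, E) x₀ y) := by
    intro a b
    have h := (hd.clm_apply (hasFDerivAt_const a _)).clm_apply (hasFDerivAt_const b _)
    refine h.congr_fderiv ?_
    ext c
    simp
  have h2 : (fun z => chartHessian cov f x₀ z a b) =ᶠ[𝓝 (extChartAt 𝓘(ℝ, E) x₀ y)]
      fun z => chartHessian cov f x₀ z b a := by
    have hz := extChartAt_mem_target hy
    have hc : ContinuousAt (extChartAt 𝓘(ℝ, E) x₀).symm (extChartAt 𝓘(ℝ, E) x₀ y) :=
      (continuousOn_extChartAt_symm x₀).continuousAt ((isOpen_extChartAt_target x₀).mem_nhds hz)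
    filter_upwards [(isOpen_extChartAt_target x₀).mem_nhds hz, hc.eventually_mem
      (hC.mem_nhds (by rwa [extChartAt_left_inv hy]))] with z hz hzC
    have h := chartHessian_symm cov hC hf htorsion (extChartAt_symm_mem hz) hzC a b
    rwa [(extChartAt 𝓘(ℝ, E) x₀).right_inv hz] at h
  have h3 := ((h1 a b).congr_of_eventuallyEq h2.symm).unique (h1 b a)
  simpa using congrArg (fun L => L c) h3

end TensorsInCharts

/-! ### The geodesic equation in an arbitrary chart -/

section GeodesicsInCharts

variable {E : Type*} [NormedAddCommGroup E] [NormedSpace ℝ E] [FiniteDimensional ℝ E]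
  {M : Type*} [TopologicalSpace M] [ChartedSpace E M] [IsManifold 𝓘(ℝ, E) ∞ M]

/-- The components in the chart at `x₀` of the velocity of a curve. -/
def chartVelocity (x₀ : M) (γ : ℝ → M) (s : Set ℝ) (t : ℝ) : E :=
  toChart x₀ (γ t) (velocity γ s t)

lemma hasMFDerivWithinAt_curve {γ : ℝ → M} {s : Set ℝ}
    (hγ : ContMDiffOn 𝓘(ℝ, ℝ) 𝓘(ℝ, E) ∞ γ s) {t : ℝ} (ht : t ∈ s) :
    HasMFDerivWithinAt 𝓘(ℝ, ℝ) 𝓘(ℝ, E) γ s t (mfderivWithin 𝓘(ℝ, ℝ) 𝓘(ℝ, E) γ s t) :=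
  ((hγ t ht).mdifferentiableWithinAt (by simp)).hasMFDerivWithinAt

lemma hasDerivWithinAt_comp_curve {F : Type*} [NormedAddCommGroup F] [NormedSpace ℝ F]
    {γ : ℝ → M} {s : Set ℝ} (hγ : ContMDiffOn 𝓘(ℝ, ℝ) 𝓘(ℝ, E) ∞ γ s) {t : ℝ} (ht : t ∈ s)
    {g : M → F} (hg : MDifferentiableAt 𝓘(ℝ, E) 𝓘(ℝ, F) g (γ t)) :
    HasDerivWithinAt (fun r => g (γ r)) (mvfderiv 𝓘(ℝ, E) g (γ t) (velocity γ s t)) s t := by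
  have h := hg.hasMFDerivAt.comp_hasMFDerivWithinAt t (hasMFDerivWithinAt_curve hγ ht)
  have h2 : HasFDerivWithinAt (fun r => g (γ r)) ((mvfderiv 𝓘(ℝ, E) g (γ t)).comp
      (mfderivWithin 𝓘(ℝ, ℝ) 𝓘(ℝ, E) γ s t) : ℝ →L[ℝ] F) s t :=
    hasMFDerivWithinAt_iff_hasFDerivWithinAt.1 h
  exact h2.hasDerivWithinAt

lemma hasDerivWithinAt_chart_curve {γ : ℝ → M} {s : Set ℝ}
    (hγ : ContMDiffOn 𝓘(ℝ, ℝ) 𝓘(ℝ, E) ∞ γ s) {x₀ : M} {t : ℝ} (ht : t ∈ s)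
    (hx₀ : γ t ∈ (chartAt E x₀).source) :
    HasDerivWithinAt (fun r => extChartAt 𝓘(ℝ, E) x₀ (γ r)) (chartVelocity x₀ γ s t) s t := by
  have h := hasDerivWithinAt_comp_curve hγ ht (mdifferentiableAt_extChartAt (I := 𝓘(ℝ, E)) hx₀)
  have h2 := mvfderiv_of_comp_chart (g := extChartAt 𝓘(ℝ, E) x₀) hx₀ (g' := id)
    (Eventually.of_forall fun _ => rfl) differentiableAt_id (velocity γ s t)
  rwa [h2, fderiv_id] at h

lemma eventually_mem_source {γ : ℝ → M} {s : Set ℝ} {x₀ : M} {t : ℝ}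
    (hγ : ContinuousWithinAt γ s t) (hx₀ : γ t ∈ (chartAt E x₀).source) :
    ∀ᶠ r in 𝓝[s] t, γ r ∈ (chartAt E x₀).source :=
  hγ.eventually_mem ((chartAt E x₀).open_source.mem_nhds hx₀)

lemma differentiableWithinAt_chartVelocity {γ : ℝ → M} {s : Set ℝ} (hs : UniqueDiffOn ℝ s)
    (hγ : ContMDiffOn 𝓘(ℝ, ℝ) 𝓘(ℝ, E) ∞ γ s) {x₀ : M} {t : ℝ} (ht : t ∈ s)
    (hx₀ : γ t ∈ (chartAt E x₀).source) :
    DifferentiableWithinAt ℝ (chartVelocity (E := E) x₀ γ s) s t := by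
  have h1 : ContDiffWithinAt ℝ ∞ (fun r => extChartAt 𝓘(ℝ, E) x₀ (γ r)) s t :=
    ((contMDiffAt_extChartAt' (I := 𝓘(ℝ, E)) (n := ∞) hx₀).comp_contMDiffWithinAt t
      (hγ t ht)).contDiffWithinAt
  have h2 := (h1.fderivWithin_right (m := 1) hs (WithTop.coe_le_coe.2 le_top) ht)
  have h3 := (h2.differentiableWithinAt (by simp)).clm_apply
    (differentiableWithinAt_const (1 : ℝ))
  refine h3.congr_of_eventuallyEq_of_mem ?_ ht
  filter_upwards [eventually_mem_source (hγ.continuousOn t ht) hx₀, self_mem_nhdsWithin] with r hr hrs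
  exact ((hasDerivWithinAt_chart_curve hγ hrs hr).derivWithin (hs r hrs)).symm

/-- The change of components of tangent vectors from the chart at `x₁` to the chart at `x₀`. -/
def coordChange (x₁ x₀ y : M) : E →L[ℝ] E :=
  (toChart x₀ y).comp (ofChart x₁ y)

lemma mdifferentiableAt_coordChange {x₁ x₀ y : M} (h₁ : y ∈ (chartAt E x₁).source)
    (h₀ : y ∈ (chartAt E x₀).source) :
    MDifferentiableAt 𝓘(ℝ, E) 𝓘(ℝ, E →L[ℝ] E) (coordChange (E := E) x₁ x₀) y := by
  have h := mdifferentiableAt_coordChangeL (IB := 𝓘(ℝ, E))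
    (e := trivializationAt E (TangentSpace 𝓘(ℝ, E) : M → Type _) x₁)
    (e' := trivializationAt E (TangentSpace 𝓘(ℝ, E) : M → Type _) x₀)
    (mem_baseSet h₁) (mem_baseSet h₀)
  refine h.congr_of_eventuallyEq ?_
  filter_upwards [(chartAt E x₁).open_source.mem_nhds h₁,
    (chartAt E x₀).open_source.mem_nhds h₀] with x hx₁ hx₀
  ext a
  rw [ContinuousLinearEquiv.coe_coe, Trivialization.coordChangeL_apply _ _
    ⟨mem_baseSet hx₁, mem_baseSet hx₀⟩, trivializationAt_symm hx₁, trivializationAt_snd hx₀]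
  rfl

variable (cov : CovariantDerivative 𝓘(ℝ, E) E (TangentSpace 𝓘(ℝ, E) : M → Type _))

/-- `covDerivAlong` is written in the chart at `γ t`. The components in the chart at `x₀` are
obtained by applying `coordChange`; in the product rule, the derivative of `coordChange` is the same
term that arises when `cov` of the extended velocity is expressed at `x₀`. -/
lemma IsGeodesicOn.hasDerivWithinAt_chartVelocity {γ : ℝ → M} {s : Set ℝ} (hs : UniqueDiffOn ℝ s)
    (hγ : IsGeodesicOn cov γ s) {x₀ : M} {t : ℝ} (ht : t ∈ s)
    (hx₀ : γ t ∈ (chartAt E x₀).source) :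
    HasDerivWithinAt (chartVelocity (E := E) x₀ γ s)
      (-christoffel cov x₀ (extChartAt 𝓘(ℝ, E) x₀ (γ t)) (chartVelocity x₀ γ s t)
        (chartVelocity x₀ γ s t)) s t := by
  have hx₁ := mem_chart_source E (γ t)
  have hcont := hγ.1.continuousOn t ht
  have hev := eventually_mem_source hcont hx₁
  have hd := (differentiableWithinAt_chartVelocity hs hγ.1 ht hx₁).hasDerivWithinAt
  have hT := hasDerivWithinAt_comp_curve hγ.1 ht (mdifferentiableAt_coordChange hx₁ hx₀)
  have h1 : HasDerivWithinAt (chartVelocity (E := E) x₀ γ s) _ s t :=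
    (hT.clm_apply hd).congr_of_eventuallyEq_of_mem (by
      filter_upwards [hev] with r hr
      rw [coordChange, ContinuousLinearMap.comp_apply, chartVelocity, chartVelocity,
        ofChart_toChart hr]) ht
  have hgeo := hγ.2 t ht
  have hD : derivWithin (fun r : ℝ =>
        ((trivializationAt E (TangentSpace 𝓘(ℝ, E) : M → Type _) (γ t))
          (⟨γ r, velocity γ s r⟩ : TangentBundle 𝓘(ℝ, E) M)).2) s t =
      derivWithin (chartVelocity (E := E) (γ t) γ s) s t := by
    refine Filter.EventuallyEq.derivWithin_eq_of_mem ?_ ht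
    filter_upwards [hev] with r hr
    exact trivializationAt_snd hr _
  rw [covDerivAlong, trivializationAt_symm hx₁, hD] at hgeo
  have hgeo' := congrArg (toChart x₀ (γ t)) hgeo
  have hW : (fun x => toChart x₀ x (FiberBundle.extend E (velocity γ s t) x)) =ᶠ[𝓝 (γ t)]
      fun x => coordChange (E := E) (γ t) x₀ x (chartVelocity (γ t) γ s t) := by
    filter_upwards [(chartAt E (γ t)).open_source.mem_nhds hx₁] with x hx
    rw [extend_eq hx]
    rfl
  have hTc : MDifferentiableAt 𝓘(ℝ, E) 𝓘(ℝ, E)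
      (fun x => coordChange (E := E) (γ t) x₀ x (chartVelocity (γ t) γ s t)) (γ t) :=
    (mdifferentiableAt_coordChange hx₁ hx₀).clm_apply mdifferentiableAt_const
  have hW' : mvfderiv 𝓘(ℝ, E) (fun x => toChart x₀ x (FiberBundle.extend E (velocity γ s t) x))
      (γ t) (velocity γ s t) =
      mvfderiv 𝓘(ℝ, E) (coordChange (E := E) (γ t) x₀) (γ t) (velocity γ s t)
        (chartVelocity (γ t) γ s t) := by
    have ha := hasDerivWithinAt_comp_curve hγ.1 ht (hTc.congr_of_eventuallyEq hW)
    have hb := (hT.clm_apply (hasDerivWithinAt_const t s (chartVelocity (γ t) γ s t)))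
    have hc : HasDerivWithinAt
      (fun r => toChart x₀ (γ r) (FiberBundle.extend E (velocity γ s t) (γ r))) _ s t :=
      hb.congr_of_eventuallyEq_of_mem (hcont.eventually hW) ht
    simpa using (hs t ht).eq_deriv _ ha hc
  rw [map_add, toChart_cov cov hx₀ (FiberBundle.mdifferentiableAt_extend ..), map_zero,
    FiberBundle.extend_apply_self, hW'] at hgeo'
  refine h1.congr_deriv ?_
  rw [eq_neg_iff_add_eq_zero, ← hgeo']
  simp only [coordChange, ContinuousLinearMap.comp_apply, chartVelocity]
  abel

end GeodesicsInCharts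

/-! ### One-variable inequalities behind self-concordance -/

section RealAnalysis

lemma le_of_forall_pos_continuous {F G : ℝ → ℝ} (hF : Continuous F) (hG : Continuous G)
    (h : ∀ ε > 0, F ε ≤ G ε) : F 0 ≤ G 0 := by
  have h1 : Tendsto F (𝓝[>] 0) (𝓝 (F 0)) := hF.continuousAt.mono_left nhdsWithin_le_nhds
  have h2 : Tendsto G (𝓝[>] 0) (𝓝 (G 0)) := hG.continuousAt.mono_left nhdsWithin_le_nhds
  exact le_of_tendsto_of_tendsto h1 h2 (by filter_upwards [self_mem_nhdsWithin] with ε hε using h ε hε)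

/-- The function 1/√p has derivative -p'/(2p^{3/2}), bounded by σ. Since p may vanish, the argument
is run for p + ε and the denominators are cleared before ε → 0. -/
lemma abs_sqrt_sub_sqrt_le {p p' : ℝ → ℝ} {b σ : ℝ} (hσ : 0 ≤ σ)
    (hp : ∀ t ∈ Icc 0 b, HasDerivWithinAt p (p' t) (Icc 0 b) t)
    (hnn : ∀ t ∈ Icc 0 b, 0 ≤ p t)
    (hbd : ∀ t ∈ Icc 0 b, |p' t| ≤ 2 * σ * √(p t) * p t) {t : ℝ} (ht : t ∈ Icc 0 b) :
    |√(p t) - √(p 0)| ≤ σ * t * (√(p t) * √(p 0)) := by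
  have h0 : (0 : ℝ) ∈ Icc 0 b := ⟨le_rfl, ht.1.trans ht.2⟩
  have key : ∀ ε > 0, |√(p t + ε) - √(p 0 + ε)| ≤ σ * t * (√(p t + ε) * √(p 0 + ε)) := by
    intro ε hε
    have hpos : ∀ r ∈ Icc 0 b, 0 < p r + ε := fun r hr => by linarith [hnn r hr]
    have hQ : ∀ r ∈ Icc 0 b, HasDerivWithinAt (fun r => (√(p r + ε))⁻¹)
        (-(p' r / (2 * √(p r + ε))) / √(p r + ε) ^ 2) (Icc 0 b) r := fun r hr =>
      (((hp r hr).add_const ε).sqrt (hpos r hr).ne').fun_inv (Real.sqrt_pos.2 (hpos r hr)).ne'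
    have hQ' : ∀ r ∈ Icc 0 b, ‖-(p' r / (2 * √(p r + ε))) / √(p r + ε) ^ 2‖ ≤ σ := by
      intro r hr
      have hP := Real.sqrt_pos.2 (hpos r hr)
      have hP2 := Real.sq_sqrt (hpos r hr).le
      have h1 : √(p r) ≤ √(p r + ε) := Real.sqrt_le_sqrt (by linarith)
      have h2 := hbd r hr
      have h3 : √(p r) * p r ≤ √(p r + ε) * √(p r + ε) ^ 2 :=
        mul_le_mul h1 (by linarith) (hnn r hr) hP.le
      rw [Real.norm_eq_abs, abs_div, abs_neg, abs_div, abs_of_pos (by positivity : 0 < √(p r + ε) ^ 2),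
        abs_of_pos (by positivity : 0 < 2 * √(p r + ε)), div_div, div_le_iff₀ (by positivity)]
      nlinarith
    have h := (convex_Icc 0 b).norm_image_sub_le_of_norm_hasDerivWithin_le hQ hQ' h0 ht
    have hPt := Real.sqrt_pos.2 (hpos t ht)
    have hP0 := Real.sqrt_pos.2 (hpos 0 h0)
    rw [Real.norm_eq_abs, Real.norm_eq_abs, sub_zero, abs_of_nonneg ht.1,
      inv_sub_inv hPt.ne' hP0.ne', abs_div, abs_of_pos (mul_pos hPt hP0),
      div_le_iff₀ (mul_pos hPt hP0), abs_sub_comm] at h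
    exact h
  have h := le_of_forall_pos_continuous (F := fun ε => |√(p t + ε) - √(p 0 + ε)|)
    (G := fun ε => σ * t * (√(p t + ε) * √(p 0 + ε))) (by fun_prop) (by fun_prop) key
  simpa using h

lemma abs_sub_le_of_second_deriv_le {φ φ₁ p : ℝ → ℝ} {b P : ℝ} (hb1 : b ≤ 1) (hP : 0 ≤ P)
    (hφ : ∀ t ∈ Icc 0 b, HasDerivWithinAt φ (φ₁ t) (Icc 0 b) t)
    (hφ₁ : ∀ t ∈ Icc 0 b, HasDerivWithinAt φ₁ (p t) (Icc 0 b) t)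
    (hp : ∀ t ∈ Icc 0 b, |p t| ≤ P) {t : ℝ} (ht : t ∈ Icc 0 b) :
    |φ t - φ 0| ≤ |φ₁ 0| + P := by
  have h0 : (0 : ℝ) ∈ Icc 0 b := ⟨le_rfl, ht.1.trans ht.2⟩
  have h1 : ∀ r ∈ Icc 0 b, ‖φ₁ r‖ ≤ |φ₁ 0| + P := by
    intro r hr
    have h := (convex_Icc 0 b).norm_image_sub_le_of_norm_hasDerivWithin_le hφ₁ hp h0 hr
    rw [Real.norm_eq_abs, Real.norm_eq_abs, sub_zero, abs_of_nonneg hr.1] at h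
    have h2 : P * r ≤ P := mul_le_of_le_one_right hP (hr.2.trans hb1)
    have h3 := abs_sub_abs_le_abs_sub (φ₁ r) (φ₁ 0)
    rw [Real.norm_eq_abs]
    linarith
  have h := (convex_Icc 0 b).norm_image_sub_le_of_norm_hasDerivWithin_le hφ h1 h0 ht
  rw [Real.norm_eq_abs, Real.norm_eq_abs, sub_zero, abs_of_nonneg ht.1] at h
  exact h.trans (mul_le_of_le_one_right (by positivity) (ht.2.trans hb1))

/-- For g = √G the hypothesis reads g' ≤ 2σ(1-t)p + σ√p g. As σ√p ≤ σl/(1-σlt), the integrating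
factor 1 - σlt absorbs the last term, leaving ((1-σlt) g)' ≤ K(1-t). Integration gives (1-σl) g(1) ≤
K/2. The shift by ε is needed because G vanishes at 0. -/
lemma sqrt_le_of_newton_ode {G G' p : ℝ → ℝ} {σ l : ℝ} (hσ : 0 ≤ σ) (hl : 0 ≤ l)
    (hs : σ * l < 1) (hG : ∀ t ∈ Icc (0 : ℝ) 1, HasDerivWithinAt G (G' t) (Icc 0 1) t)
    (hG0 : G 0 = 0) (hnn : ∀ t ∈ Icc (0 : ℝ) 1, 0 ≤ G t)
    (hpnn : ∀ t ∈ Icc (0 : ℝ) 1, 0 ≤ p t)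
    (hp : ∀ t ∈ Icc (0 : ℝ) 1, √(p t) * (1 - σ * l * t) ≤ l)
    (hbd : ∀ t ∈ Icc (0 : ℝ) 1,
      G' t ≤ 2 * ((1 - t) * (2 * σ * p t)) * √(G t) + 2 * σ * √(p t) * G t) :
    √(G 1) ≤ σ * l ^ 2 / (1 - σ * l) ^ 2 := by
  have hs' : 0 < 1 - σ * l := by linarith
  -- Bounds 2σ(1-σlt)p, using p ≤ l²/(1-σlt)² and 1-σlt ≥ 1-σl.
  set K := 2 * σ * l ^ 2 / (1 - σ * l) with hK
  have key : ∀ ε > 0, (1 - σ * l) * √(G 1 + ε) - K / 2 ≤ √ε := by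
    intro ε hε
    have hpos : ∀ r ∈ Icc (0 : ℝ) 1, 0 < G r + ε := fun r hr => by linarith [hnn r hr]
    have hR : ∀ t ∈ Icc (0 : ℝ) 1, HasDerivWithinAt
        (fun t => (1 - σ * l * t) * √(G t + ε) - K * (t - t ^ 2 / 2))
        ((-(σ * l)) * √(G t + ε) + (1 - σ * l * t) * (G' t / (2 * √(G t + ε))) - K * (1 - t))
        (Icc 0 1) t := by
      intro t ht
      have h1 : HasDerivWithinAt (fun t : ℝ => 1 - σ * l * t) (-(σ * l)) (Icc 0 1) t := by
        simpa using ((hasDerivWithinAt_id t (Icc 0 1)).const_mul (σ * l)).const_sub 1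
      have h2 : HasDerivWithinAt (fun t : ℝ => t - t ^ 2 / 2) (1 - t) (Icc 0 1) t := by
        have := (hasDerivWithinAt_id t (Icc 0 1)).sub
          (((hasDerivWithinAt_id t (Icc 0 1)).pow 2).div_const 2)
        refine this.congr_deriv ?_
        simp
      exact (h1.mul (((hG t ht).add_const ε).sqrt (hpos t ht).ne')).sub (h2.const_mul K)
    have hanti : AntitoneOn (fun t => (1 - σ * l * t) * √(G t + ε) - K * (t - t ^ 2 / 2))
        (Icc 0 1) := by
      refine antitoneOn_of_hasDerivWithinAt_nonpos (convex_Icc 0 1)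
        (fun t ht => (hR t ht).continuousWithinAt)
        (fun t ht => (hR t (interior_subset ht)).mono interior_subset) ?_
      intro t ht'
      have ht := interior_subset ht'
      have hQ := Real.sqrt_pos.2 (hpos t ht)
      have hQ2 := Real.sq_sqrt (hpos t ht).le
      have h1 : √(G t) ≤ √(G t + ε) := Real.sqrt_le_sqrt (by linarith)
      have hst : σ * l * t ≤ σ * l := mul_le_of_le_one_right (by positivity) ht.2
      have hw : 0 < 1 - σ * l * t := by linarith
      have hpsq := Real.sq_sqrt (hpnn t ht)
      have hdiv : G' t / (2 * √(G t + ε)) ≤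
          (1 - t) * (2 * σ * p t) + σ * √(p t) * √(G t + ε) := by
        rw [div_le_iff₀ (by positivity)]
        refine (hbd t ht).trans ?_
        have ha : 2 * ((1 - t) * (2 * σ * p t)) * √(G t) ≤
            2 * ((1 - t) * (2 * σ * p t)) * √(G t + ε) :=
          mul_le_mul_of_nonneg_left h1 (by
            have := hpnn t ht
            have := ht.2
            have : 0 ≤ 1 - t := by linarith
            positivity)
        have hb : 2 * σ * √(p t) * G t ≤ 2 * σ * √(p t) * √(G t + ε) ^ 2 :=
          mul_le_mul_of_nonneg_left (by linarith) (by positivity)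
        nlinarith
      have hA : (1 - σ * l * t) * p t ≤ l ^ 2 / (1 - σ * l) := by
        rw [le_div_iff₀ hs']
        have h3 : (√(p t) * (1 - σ * l * t)) ^ 2 ≤ l ^ 2 :=
          pow_le_pow_left₀ (by positivity) (hp t ht) 2
        have h4 : (1 - σ * l * t) * p t * (1 - σ * l) ≤
            (1 - σ * l * t) * p t * (1 - σ * l * t) :=
          mul_le_mul_of_nonneg_left (by linarith) (mul_nonneg hw.le (hpnn t ht))
        calc _ ≤ (1 - σ * l * t) * p t * (1 - σ * l * t) := h4
          _ = (√(p t) * (1 - σ * l * t)) ^ 2 := by rw [mul_pow, hpsq]; ring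
          _ ≤ _ := h3
      have hB : (1 - σ * l * t) * ((1 - t) * (2 * σ * p t)) ≤ K * (1 - t) := by
        have h5 : 0 ≤ 2 * σ * (1 - t) := by
          have := ht.2
          have : 0 ≤ 1 - t := by linarith
          positivity
        calc _ = 2 * σ * (1 - t) * ((1 - σ * l * t) * p t) := by ring
          _ ≤ 2 * σ * (1 - t) * (l ^ 2 / (1 - σ * l)) := mul_le_mul_of_nonneg_left hA h5
          _ = _ := by rw [hK]; ring
      have hC : (1 - σ * l * t) * (σ * √(p t) * √(G t + ε)) ≤ σ * l * √(G t + ε) := by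
        calc _ = σ * √(G t + ε) * (√(p t) * (1 - σ * l * t)) := by ring
          _ ≤ σ * √(G t + ε) * l := mul_le_mul_of_nonneg_left (hp t ht) (by positivity)
          _ = _ := by ring
      have hD := mul_le_mul_of_nonneg_left hdiv hw.le
      linarith
    have h := hanti (left_mem_Icc.2 zero_le_one) (right_mem_Icc.2 zero_le_one) zero_le_one
    simp only [hG0] at h
    norm_num at h
    linarith
  have h := le_of_forall_pos_continuous (F := fun ε => (1 - σ * l) * √(G 1 + ε) - K / 2)
    (G := fun ε => √ε) (by fun_prop) (by fun_prop) key
  simp only [add_zero, Real.sqrt_zero] at h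
  rw [le_div_iff₀ (by positivity)]
  have h2 : K * (1 - σ * l) = 2 * σ * l ^ 2 := by rw [hK]; field_simp
  nlinarith

lemma abs_sqrt_sub_sqrt_le_right {p p' : ℝ → ℝ} {σ : ℝ} (hσ : 0 ≤ σ)
    (hp : ∀ t ∈ Icc (0 : ℝ) 1, HasDerivWithinAt p (p' t) (Icc 0 1) t)
    (hnn : ∀ t ∈ Icc (0 : ℝ) 1, 0 ≤ p t)
    (hbd : ∀ t ∈ Icc (0 : ℝ) 1, |p' t| ≤ 2 * σ * √(p t) * p t) {t : ℝ} (ht : t ∈ Icc (0 : ℝ) 1) :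
    |√(p (1 - t)) - √(p 1)| ≤ σ * t * (√(p (1 - t)) * √(p 1)) := by
  have hmaps : MapsTo (fun t : ℝ => 1 - t) (Icc 0 1) (Icc 0 1) := fun t ht =>
    ⟨by linarith [ht.2], by linarith [ht.1]⟩
  have h := abs_sqrt_sub_sqrt_le (p := fun t => p (1 - t)) (p' := fun t => -p' (1 - t)) hσ
    (fun t ht => ((hp _ (hmaps ht)).scomp t
      ((hasDerivWithinAt_id t (Icc (0 : ℝ) 1)).const_sub 1) hmaps).congr_deriv (by simp))
    (fun t ht => hnn _ (hmaps ht)) (fun t ht => by simpa using hbd _ (hmaps ht)) ht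
  simpa using h

/-- Data of a function along a geodesic segment: `φ` is the function, `φ₁` its derivative, `p` the
second derivative. -/
structure SelfConcordantAlong (φ φ₁ p : ℝ → ℝ) (σ : ℝ) : Prop where
  deriv : ∀ t ∈ Icc (0 : ℝ) 1, HasDerivWithinAt φ (φ₁ t) (Icc 0 1) t
  deriv₁ : ∀ t ∈ Icc (0 : ℝ) 1, HasDerivWithinAt φ₁ (p t) (Icc 0 1) t
  nonneg : ∀ t ∈ Icc (0 : ℝ) 1, 0 ≤ p t
  bound : ∀ t ∈ Icc (0 : ℝ) 1, |√(p t) - √(p 0)| ≤ σ * t * (√(p t) * √(p 0))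

lemma SelfConcordantAlong.mono {φ φ₁ p : ℝ → ℝ} {σ σ' : ℝ} (h : SelfConcordantAlong φ φ₁ p σ)
    (hσ : σ ≤ σ') : SelfConcordantAlong φ φ₁ p σ' where
  deriv := h.deriv
  deriv₁ := h.deriv₁
  nonneg := h.nonneg
  bound t ht := (h.bound t ht).trans <| by
    have := ht.1
    gcongr

/-- The bound gives p(t) ≥ r²/(1+σrt)² with r = √p(0), and the left side is the integral of this
from 0 to t. -/
lemma SelfConcordantAlong.deriv_sub_ge {φ φ₁ p : ℝ → ℝ} {σ : ℝ}
    (h : SelfConcordantAlong φ φ₁ p σ) (hσ : 0 ≤ σ) {t : ℝ} (ht : t ∈ Icc (0 : ℝ) 1) :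
    √(p 0) ^ 2 * t / (1 + σ * √(p 0) * t) ≤ φ₁ t - φ₁ 0 := by
  set r := √(p 0)
  have hr : 0 ≤ r := Real.sqrt_nonneg _
  have hD : ∀ t ∈ Icc (0 : ℝ) 1, HasDerivWithinAt
      (fun t => φ₁ t - r ^ 2 * t / (1 + σ * r * t))
      (p t - (r ^ 2 * (1 + σ * r * t) - r ^ 2 * t * (σ * r)) / (1 + σ * r * t) ^ 2)
      (Icc 0 1) t := by
    intro t ht
    have ht0 := ht.1
    have h1 : HasDerivWithinAt (fun t : ℝ => r ^ 2 * t) (r ^ 2) (Icc 0 1) t := by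
      simpa using (hasDerivWithinAt_id t (Icc 0 1)).const_mul (r ^ 2)
    have h2 : HasDerivWithinAt (fun t : ℝ => 1 + σ * r * t) (σ * r) (Icc 0 1) t := by
      simpa using ((hasDerivWithinAt_id t (Icc 0 1)).const_mul (σ * r)).const_add 1
    exact (h.deriv₁ t ht).sub (h1.div h2 (by positivity))
  have hmono : MonotoneOn (fun t => φ₁ t - r ^ 2 * t / (1 + σ * r * t)) (Icc 0 1) := by
    refine monotoneOn_of_hasDerivWithinAt_nonneg (convex_Icc 0 1)
      (fun t ht => (hD t ht).continuousWithinAt)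
      (fun t ht => (hD t (interior_subset ht)).mono interior_subset) ?_
    intro t ht'
    have ht := interior_subset ht'
    have ht0 := ht.1
    have h1 := (abs_le.1 (h.bound t ht)).1
    have h2 : r ≤ √(p t) * (1 + σ * r * t) := by
      linarith [h1, mul_comm (σ * t) (√(p t) * r)]
    have h3 : r ^ 2 ≤ p t * (1 + σ * r * t) ^ 2 := by
      rw [← Real.sq_sqrt (h.nonneg t ht), ← mul_pow]
      exact pow_le_pow_left₀ hr h2 2
    rw [sub_nonneg, div_le_iff₀ (by positivity)]
    linarith
  have := hmono (left_mem_Icc.2 zero_le_one) ht ht.1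
  simp only [mul_zero, zero_div, sub_zero] at this
  linarith

/-- A second integration. It divides by σ, so σ = 0 is handled later by enlarging σ with
`SelfConcordantAlong.mono`. -/
lemma SelfConcordantAlong.sub_ge {φ φ₁ p : ℝ → ℝ} {σ : ℝ}
    (h : SelfConcordantAlong φ φ₁ p σ) (hσ : 0 < σ) :
    φ₁ 0 + √(p 0) / σ - Real.log (1 + σ * √(p 0)) / σ ^ 2 ≤ φ 1 - φ 0 := by
  set r := √(p 0) with hr'
  have hr : 0 ≤ r := Real.sqrt_nonneg _
  have hD : ∀ t ∈ Icc (0 : ℝ) 1, HasDerivWithinAt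
      (fun t => φ t - (φ₁ 0 + r / σ) * t + Real.log (1 + σ * r * t) / σ ^ 2)
      (φ₁ t - (φ₁ 0 + r / σ) + σ * r / (1 + σ * r * t) / σ ^ 2) (Icc 0 1) t := by
    intro t ht
    have ht0 := ht.1
    have h1 : HasDerivWithinAt (fun t : ℝ => (φ₁ 0 + r / σ) * t) (φ₁ 0 + r / σ) (Icc 0 1) t := by
      simpa using (hasDerivWithinAt_id t (Icc 0 1)).const_mul (φ₁ 0 + r / σ)
    have h2 : HasDerivWithinAt (fun t : ℝ => 1 + σ * r * t) (σ * r) (Icc 0 1) t := by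
      simpa using ((hasDerivWithinAt_id t (Icc 0 1)).const_mul (σ * r)).const_add 1
    exact ((h.deriv t ht).sub h1).add ((h2.log (by positivity)).div_const _)
  have hmono : MonotoneOn
      (fun t => φ t - (φ₁ 0 + r / σ) * t + Real.log (1 + σ * r * t) / σ ^ 2) (Icc 0 1) := by
    refine monotoneOn_of_hasDerivWithinAt_nonneg (convex_Icc 0 1)
      (fun t ht => (hD t ht).continuousWithinAt)
      (fun t ht => (hD t (interior_subset ht)).mono interior_subset) ?_
    intro t ht'
    have ht := interior_subset ht'
    have ht0 := ht.1
    have h1 := h.deriv_sub_ge hσ.le ht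
    rw [← hr'] at h1
    have hpos : 0 < 1 + σ * r * t := by positivity
    have h2 : r / σ - σ * r / (1 + σ * r * t) / σ ^ 2 = r ^ 2 * t / (1 + σ * r * t) := by
      field_simp
      ring
    linarith
  have := hmono (left_mem_Icc.2 zero_le_one) (right_mem_Icc.2 zero_le_one) zero_le_one
  simp only [mul_zero, add_zero, Real.log_one, zero_div, sub_zero, mul_one] at this
  linarith

/-- Time reversal of `deriv_sub_ge`. Reversing the real functions avoids reversing the geodesic, but
the comparison with the value at 1 has to be supplied as `hb`. -/
lemma SelfConcordantAlong.deriv_sub_ge_right {φ φ₁ p : ℝ → ℝ} {σ : ℝ}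
    (h : SelfConcordantAlong φ φ₁ p σ) (hσ : 0 ≤ σ)
    (hb : ∀ t ∈ Icc (0 : ℝ) 1, |√(p (1 - t)) - √(p 1)| ≤ σ * t * (√(p (1 - t)) * √(p 1))) :
    √(p 1) ^ 2 / (1 + σ * √(p 1)) ≤ φ₁ 1 - φ₁ 0 := by
  have hmaps : MapsTo (fun t : ℝ => 1 - t) (Icc 0 1) (Icc 0 1) := fun t ht =>
    ⟨by linarith [ht.2], by linarith [ht.1]⟩
  have hrev : ∀ t : ℝ, HasDerivWithinAt (fun t : ℝ => 1 - t) (-1) (Icc 0 1) t := fun t =>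
    (hasDerivWithinAt_id t (Icc (0 : ℝ) 1)).const_sub 1
  have h' : SelfConcordantAlong (fun t => φ (1 - t)) (fun t => -φ₁ (1 - t)) (fun t => p (1 - t))
      σ := by
    refine ⟨fun t ht => ?_, fun t ht => ?_, fun t ht => h.nonneg _ (hmaps ht), ?_⟩
    · exact ((h.deriv _ (hmaps ht)).scomp t (hrev t) hmaps).congr_deriv (by simp)
    · exact ((h.deriv₁ _ (hmaps ht)).scomp t (hrev t) hmaps).neg.congr_deriv (by simp)
    · simpa using hb
  have := h'.deriv_sub_ge hσ (right_mem_Icc.2 zero_le_one)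
  simp only [sub_zero, mul_one, sub_self] at this
  linarith

/-- Here log(1+z) ≤ 2√z, because exp(√z)² ≥ (1+√z)² ≥ 1+z; dividing cz ≤ 2√z by √z gives the bound.
-/
lemma le_of_mul_le_log {c z : ℝ} (hc : 0 < c) (hz : 0 ≤ z) (h : c * z ≤ Real.log (1 + z)) :
    z ≤ 4 / c ^ 2 := by
  have h1 : Real.log (1 + z) ≤ 2 * √z := by
    rw [Real.log_le_iff_le_exp (by positivity), two_mul, Real.exp_add]
    have h2 := Real.add_one_le_exp (√z)
    have h3 := Real.sq_sqrt hz
    have h4 := Real.sqrt_nonneg z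
    nlinarith
  rw [le_div_iff₀ (by positivity)]
  have h3 := Real.sq_sqrt hz
  have h4 := Real.sqrt_nonneg z
  have h5 : √z * (c * √z) ≤ √z * 2 := by nlinarith
  rcases h4.eq_or_lt with h6 | h6
  · rw [← h3, ← h6]; norm_num
  · have h7 := le_of_mul_le_mul_left h5 h6
    have h8 : (c * √z) ^ 2 ≤ 2 ^ 2 := pow_le_pow_left₀ (by positivity) h7 2
    rw [mul_pow, h3] at h8
    linarith

end RealAnalysis

lemma _root_.DifferentiableAt.comp_hasDerivWithinAt' {A B : Type*} [NormedAddCommGroup A]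
    [NormedSpace ℝ A] [NormedAddCommGroup B] [NormedSpace ℝ B] {g : A → B} {h : ℝ → A} {h' : A}
    {s : Set ℝ} {t : ℝ} (hg : DifferentiableAt ℝ g (h t)) (hh : HasDerivWithinAt h h' s t) :
    HasDerivWithinAt (fun r => g (h r)) (fderiv ℝ g (h t) h') s t :=
  hg.hasFDerivAt.comp_hasDerivWithinAt t hh

/-! ### Symmetric and positive definite bilinear forms -/

section LinearAlgebra

variable {V : Type*} [NormedAddCommGroup V] [NormedSpace ℝ V]

/-- Polarization: 4B(u,v) = B(u+v,u+v) - B(u-v,u-v), and the parallelogram law for H gives |B(u,v)|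
≤ (K/2)(H(u,u)+H(v,v)). Rescaling u and v to equal H-norm turns the arithmetic mean into the
geometric one. -/
lemma abs_bilin_le {B H : V →L[ℝ] V →L[ℝ] ℝ} {K : ℝ} (hB : ∀ u v, B u v = B v u)
    (hH : ∀ u v, H u v = H v u) (hpos : ∀ u, u ≠ 0 → 0 < H u u)
    (hBH : ∀ u, |B u u| ≤ K * H u u) (u v : V) : |B u v| ≤ K * (√(H u u) * √(H v v)) := by
  rcases eq_or_ne u 0 with rfl | hu
  · simp
  rcases eq_or_ne v 0 with rfl | hv
  · simp
  have key : ∀ u v : V, |B u v| ≤ K / 2 * (H u u + H v v) := by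
    intro u v
    have h1 := abs_le.1 (hBH (u + v))
    have h2 := abs_le.1 (hBH (u - v))
    simp only [map_add, map_sub, _root_.add_apply, _root_.sub_apply] at h1 h2
    rw [hB v u, hH v u] at h1 h2
    rw [abs_le]
    constructor <;> linarith [h1.1, h1.2, h2.1, h2.2]
  have hu' := Real.sqrt_pos.2 (hpos u hu)
  have hv' := Real.sqrt_pos.2 (hpos v hv)
  have h := key (√(H v v) • u) (√(H u u) • v)
  simp only [map_smul, _root_.smul_apply, smul_eq_mul] at h
  rw [abs_mul, abs_mul, abs_of_pos hu', abs_of_pos hv'] at h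
  have e1 := Real.sq_sqrt (hpos u hu).le
  have e2 := Real.sq_sqrt (hpos v hv).le
  set a := √(H u u)
  set b := √(H v v)
  rw [← e1, ← e2] at h
  have hab : 0 < a * b := mul_pos hu' hv'
  have h3 : (a * b) * |B u v| ≤ (a * b) * (K * (a * b)) := by nlinarith
  exact le_of_mul_le_mul_left h3 hab

variable [FiniteDimensional ℝ V]

lemma exists_equiv_of_pos {H : V →L[ℝ] V →L[ℝ] ℝ} (hpos : ∀ u, u ≠ 0 → 0 < H u u) :
    ∃ e : V ≃L[ℝ] (V →L[ℝ] ℝ), (e : V →L[ℝ] V →L[ℝ] ℝ) = H := by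
  have hinj : Function.Injective H := by
    rw [injective_iff_map_eq_zero]
    intro u hu
    by_contra hne
    have := hpos u hne
    rw [hu] at this
    simp at this
  have hdim : Module.finrank ℝ V = Module.finrank ℝ (V →L[ℝ] ℝ) := by
    rw [← (LinearMap.toContinuousLinearMap (𝕜 := ℝ) (E := V) (F' := ℝ)).finrank_eq]
    exact (Subspace.dual_finrank_eq (K := ℝ) (V := V)).symm
  refine ⟨(LinearEquiv.ofInjectiveOfFinrankEq H.toLinearMap hinj hdim).toContinuousLinearEquiv, ?_⟩
  ext u v
  rfl

-- Differentiability of w = H⁻¹α comes from smoothness of inversion. Differentiating Hw = α gives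
-- Hw' = α' - H'w, which eliminates w' from the derivative of H(w,w).
set_option synthInstance.maxHeartbeats 200000 in
lemma hasDerivWithinAt_dual_norm_sq {H : ℝ → V →L[ℝ] V →L[ℝ] ℝ} {α : ℝ → V →L[ℝ] ℝ}
    {H' : V →L[ℝ] V →L[ℝ] ℝ} {α' : V →L[ℝ] ℝ} {w : ℝ → V} {s : Set ℝ} {t : ℝ}
    (hs : UniqueDiffWithinAt ℝ s t) (ht : t ∈ s) (hH : HasDerivWithinAt H H' s t)
    (hα : HasDerivWithinAt α α' s t) (hw : ∀ᶠ r in 𝓝[s] t, H r (w r) = α r)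
    (hsymm : ∀ u v, H t u v = H t v u) (hpos : ∀ u, u ≠ 0 → 0 < H t u u) :
    HasDerivWithinAt (fun r => H r (w r) (w r)) (2 * α' (w t) - H' (w t) (w t)) s t := by
  obtain ⟨e, he⟩ := exists_equiv_of_pos hpos
  have hinv : DifferentiableAt ℝ
      (ContinuousLinearMap.inverse : (V →L[ℝ] V →L[ℝ] ℝ) → ((V →L[ℝ] ℝ) →L[ℝ] V)) (H t) := by
    rw [← he]
    exact (contDiffAt_map_inverse (𝕜 := ℝ) (n := 1) e).differentiableAt (by simp)
  have hev : ∀ᶠ r in 𝓝[s] t, w r = (H r).inverse (α r) := by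
    have h1 : ∀ᶠ r in 𝓝[s] t, H r ∈ range ((↑) : (V ≃L[ℝ] (V →L[ℝ] ℝ)) → _) :=
      hH.continuousWithinAt.eventually_mem (by rw [← he]; exact e.nhds)
    filter_upwards [hw, h1] with r hr hr1
    obtain ⟨e', he'⟩ := hr1
    rw [← hr, ← he']
    simp
  have hw1 : ∃ w', HasDerivWithinAt w w' s t := by
    have h2 : HasDerivWithinAt (fun r => (H r).inverse (α r)) _ s t :=
      HasDerivWithinAt.clm_apply (hinv.comp_hasDerivWithinAt' hH) hα
    exact ⟨_, h2.congr_of_eventuallyEq_of_mem hev ht⟩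
  obtain ⟨w', hw'⟩ := hw1
  have h3 := hH.clm_apply hw'
  have h4 : H' (w t) + H t w' = α' := by
    have h5 : HasDerivWithinAt α _ s t := h3.congr_of_eventuallyEq_of_mem
      (by filter_upwards [hw] with r hr using hr.symm) ht
    exact (hs.eq_deriv _ h5 hα)
  refine (h3.clm_apply hw').congr_deriv ?_
  have h6 := congrArg (fun L : V →L[ℝ] ℝ => L (w t)) h4
  simp only [_root_.add_apply] at h6
  rw [h4, hsymm (w t) w']
  linarith

lemma exists_coercive {H : V →L[ℝ] V →L[ℝ] ℝ} (hpos : ∀ u, u ≠ 0 → 0 < H u u) :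
    ∃ c > 0, ∀ u, c * ‖u‖ ^ 2 ≤ H u u := by
  rcases subsingleton_or_nontrivial V with hV | hV
  · exact ⟨1, one_pos, fun u => by simp [Subsingleton.elim u 0]⟩
  have hcont : Continuous fun u => H u u := by fun_prop
  obtain ⟨u₀, hu₀, hmin⟩ := (isCompact_sphere (0 : V) 1).exists_isMinOn
    (NormedSpace.sphere_nonempty.2 zero_le_one) hcont.continuousOn
  have hu₀' : u₀ ≠ 0 := fun h => by simp [h] at hu₀
  refine ⟨H u₀ u₀, hpos _ hu₀', fun u => ?_⟩
  rcases eq_or_ne u 0 with rfl | hu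
  · simp
  have hn : 0 < ‖u‖ := norm_pos_iff.2 hu
  have h := hmin (show ‖u‖⁻¹ • u ∈ Metric.sphere (0 : V) 1 by
    simp [norm_smul, hn.ne'])
  simp only [Set.mem_ofPred_eq, map_smul, _root_.smul_apply, smul_eq_mul] at h
  have h2 : ‖u‖⁻¹ * (‖u‖⁻¹ * H u u) * ‖u‖ ^ 2 = H u u := by field_simp
  rw [← h2]
  exact mul_le_mul_of_nonneg_right h (by positivity)

end LinearAlgebra

/-! ### Derivatives of f, Df, Hf and of the Newton residual along a geodesic -/

section AlongGeodesics

variable {E : Type*} [NormedAddCommGroup E] [NormedSpace ℝ E] [FiniteDimensional ℝ E]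
  {M : Type*} [TopologicalSpace M] [ChartedSpace E M] [IsManifold 𝓘(ℝ, E) ∞ M]
  (cov : CovariantDerivative 𝓘(ℝ, E) E (TangentSpace 𝓘(ℝ, E) : M → Type _))
  {C : Set M} (hC : IsOpen C) {f : M → ℝ} (hf : ContMDiffOn 𝓘(ℝ, E) 𝓘(ℝ, ℝ) ∞ f C)
  {γ : ℝ → M} {s : Set ℝ} (hs : UniqueDiffOn ℝ s) (hγ : IsGeodesicOn cov γ s)
include hC hf hγ

lemma hasDerivWithinAt_along {t : ℝ} (ht : t ∈ s) (htC : γ t ∈ C) :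
    HasDerivWithinAt (fun r => f (γ r)) (differential (E := E) f (γ t) (velocity γ s t)) s t :=
  hasDerivWithinAt_comp_curve hγ.1 ht
    ((hf.contMDiffAt (hC.mem_nhds htC)).mdifferentiableAt (by simp))

lemma eventually_mem_along {t : ℝ} (ht : t ∈ s) (htC : γ t ∈ C) :
    ∀ᶠ r in 𝓝[s] t, γ r ∈ (chartAt E (γ t)).source ∧ γ r ∈ C :=
  (eventually_mem_source (hγ.1.continuousOn t ht) (mem_chart_source E (γ t))).and
    ((hγ.1.continuousOn t ht).eventually_mem (hC.mem_nhds htC))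

include hs

lemma hasDerivWithinAt_fderiv_inChart {t : ℝ} (ht : t ∈ s) (htC : γ t ∈ C) :
    HasDerivWithinAt (fun r => fderiv ℝ (inChart f (γ t)) (extChartAt 𝓘(ℝ, E) (γ t) (γ r)))
      (fderiv ℝ (fderiv ℝ (inChart f (γ t))) (extChartAt 𝓘(ℝ, E) (γ t) (γ t))
        (chartVelocity (γ t) γ s t)) s t := by
  have hx := mem_chart_source E (γ t)
  have h1 := ((contDiffAt_inChart hC hf hx htC).fderiv_right (m := 1)
    (WithTop.coe_le_coe.2 le_top)).differentiableAt (by simp)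
  exact h1.hasFDerivAt.comp_hasDerivWithinAt t (hasDerivWithinAt_chart_curve hγ.1 ht hx)

lemma hasDerivWithinAt_differential_along {t : ℝ} (ht : t ∈ s) (htC : γ t ∈ C) :
    HasDerivWithinAt (fun r => differential (E := E) f (γ r) (velocity γ s r))
      (hessian cov f (γ t) (velocity γ s t) (velocity γ s t)) s t := by
  have hx := mem_chart_source E (γ t)
  have h1 := (hasDerivWithinAt_fderiv_inChart cov hC hf hs hγ ht htC).clm_apply
    (hγ.hasDerivWithinAt_chartVelocity cov hs ht hx)
  refine (h1.congr_of_eventuallyEq_of_mem ?_ ht).congr_deriv ?_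
  · filter_upwards [eventually_mem_along cov hC hf hγ ht htC] with r hr
    exact differential_eq hC hf hr.1 hr.2 _
  · rw [hessian_eq cov hC hf hx htC, chartHessian_apply, map_neg]
    rfl

variable [T2Space M] (hsmooth : CovariantDerivative.ContMDiffCovariantDerivative cov ∞)

include hsmooth

set_option synthInstance.maxHeartbeats 200000 in
lemma hasDerivWithinAt_chartHessian_along {t : ℝ} (ht : t ∈ s) (htC : γ t ∈ C) :
    HasDerivWithinAt (fun r => chartHessian cov f (γ t) (extChartAt 𝓘(ℝ, E) (γ t) (γ r)))
      (fderiv ℝ (chartHessian cov f (γ t)) (extChartAt 𝓘(ℝ, E) (γ t) (γ t))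
        (chartVelocity (γ t) γ s t)) s t := by
  have hx := mem_chart_source E (γ t)
  exact DifferentiableAt.comp_hasDerivWithinAt' (A := E) (B := E →L[ℝ] E →L[ℝ] ℝ)
    (differentiableAt_chartHessian cov hC hf hsmooth hx htC)
    (hasDerivWithinAt_chart_curve hγ.1 ht hx)

lemma hasDerivWithinAt_hessian_along {t : ℝ} (ht : t ∈ s) (htC : γ t ∈ C) :
    HasDerivWithinAt (fun r => hessian cov f (γ r) (velocity γ s r) (velocity γ s r))
      (nablaHessian cov f (γ t) (velocity γ s t) (velocity γ s t) (velocity γ s t)) s t := by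
  have hx := mem_chart_source E (γ t)
  have hv := hγ.hasDerivWithinAt_chartVelocity cov hs ht hx
  have h1 := ((hasDerivWithinAt_chartHessian_along cov hC hf hs hγ hsmooth ht htC).clm_apply
    hv).clm_apply hv
  refine (h1.congr_of_eventuallyEq_of_mem ?_ ht).congr_deriv ?_
  · filter_upwards [eventually_mem_along cov hC hf hγ ht htC] with r hr
    exact hessian_eq cov hC hf hr.1 hr.2 _ _
  · rw [nablaHessian_eq cov hC hf hsmooth hx htC]
    simp only [map_neg, _root_.add_apply, _root_.neg_apply, chartVelocity]
    ring

variable (htorsion : ∀ (X Y : (x : M) → TangentSpace 𝓘(ℝ, E) x),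
      ContMDiff 𝓘(ℝ, E) 𝓘(ℝ, E).tangent ∞ (fun x => (⟨x, X x⟩ : TangentBundle 𝓘(ℝ, E) M)) →
      ContMDiff 𝓘(ℝ, E) 𝓘(ℝ, E).tangent ∞ (fun x => (⟨x, Y x⟩ : TangentBundle 𝓘(ℝ, E) M)) →
      ∀ x, cov Y x (X x) - cov X x (Y x) = VectorField.mlieBracket 𝓘(ℝ, E) X Y x)
  (hpos : ∀ x ∈ C, ∀ u : TangentSpace 𝓘(ℝ, E) x, u ≠ 0 → 0 < hessian cov f x u u)
include htorsion hpos

/-- The vector w represents ω_t = Df + (1-t)Hf(γ̇,·). The formula is that of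
`hasDerivWithinAt_dual_norm_sq` in the chart at `γ t`; the Christoffel terms combine so that plain
derivatives of the Hessian become covariant ones. -/
lemma hasDerivWithinAt_residual_along {w : (r : ℝ) → TangentSpace 𝓘(ℝ, E) (γ r)}
    (hw : ∀ r ∈ s, ∀ v, hessian cov f (γ r) (w r) v =
      differential f (γ r) v + (1 - r) * hessian cov f (γ r) (velocity γ s r) v)
    {t : ℝ} (ht : t ∈ s) (htC : γ t ∈ C) :
    HasDerivWithinAt (fun r => hessian cov f (γ r) (w r) (w r))
      (2 * ((1 - t) * nablaHessian cov f (γ t) (velocity γ s t) (velocity γ s t) (w t)) -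
        nablaHessian cov f (γ t) (velocity γ s t) (w t) (w t)) s t := by
  have hx := mem_chart_source E (γ t)
  have hv := hγ.hasDerivWithinAt_chartVelocity cov hs ht hx
  have hH := hasDerivWithinAt_chartHessian_along cov hC hf hs hγ hsmooth ht htC
  have hω := (hasDerivWithinAt_fderiv_inChart cov hC hf hs hγ ht htC).add
    (((hasDerivWithinAt_id t s).const_sub 1).smul (hH.clm_apply hv))
  have hev := eventually_mem_along cov hC hf hγ ht htC
  have hsymm := chartHessian_symm cov hC hf htorsion hx htC
  have hw' : ∀ r ∈ s, γ r ∈ (chartAt E (γ t)).source → γ r ∈ C →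
      chartHessian cov f (γ t) (extChartAt 𝓘(ℝ, E) (γ t) (γ r)) (toChart (γ t) (γ r) (w r)) =
      fderiv ℝ (inChart f (γ t)) (extChartAt 𝓘(ℝ, E) (γ t) (γ r)) +
        (1 - r) • chartHessian cov f (γ t) (extChartAt 𝓘(ℝ, E) (γ t) (γ r))
          (chartVelocity (γ t) γ s r) := by
    intro r hrs hr hrC
    ext a
    have h := hw r hrs (ofChart (γ t) (γ r) a)
    rw [hessian_eq cov hC hf hr hrC, hessian_eq cov hC hf hr hrC, differential_eq hC hf hr hrC,
      toChart_ofChart hr] at h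
    exact h
  have h1 := hasDerivWithinAt_dual_norm_sq (w := fun r => toChart (γ t) (γ r) (w r)) (hs t ht) ht
    hH hω (by
      filter_upwards [hev, self_mem_nhdsWithin] with r hr hrs
      exact hw' r hrs hr.1 hr.2) hsymm (by
      intro u hu
      have h := hpos (γ t) htC (ofChart (γ t) (γ t) u) (fun h0 => hu (by
        rw [← toChart_ofChart hx u, h0, map_zero]))
      rwa [hessian_eq cov hC hf hx htC, toChart_ofChart hx] at h)
  refine (h1.congr_of_eventuallyEq_of_mem ?_ ht).congr_deriv ?_
  · filter_upwards [hev] with r hr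
    exact hessian_eq cov hC hf hr.1 hr.2 _ _
  · rw [nablaHessian_eq cov hC hf hsmooth hx htC, nablaHessian_eq cov hC hf hsmooth hx htC]
    have h2 := congrArg (fun L : E →L[ℝ] ℝ => L (christoffel cov (γ t)
      (extChartAt 𝓘(ℝ, E) (γ t) (γ t)) (toChart (γ t) (γ t) (w t)) (chartVelocity (γ t) γ s t)))
      (hw' t ht hx htC)
    have h3 := chartHessian_apply cov f (γ t) (extChartAt 𝓘(ℝ, E) (γ t) (γ t))
      (chartVelocity (γ t) γ s t) (toChart (γ t) (γ t) (w t))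
    have h4 := hsymm (christoffel cov (γ t) (extChartAt 𝓘(ℝ, E) (γ t) (γ t))
      (toChart (γ t) (γ t) (w t)) (chartVelocity (γ t) γ s t)) (toChart (γ t) (γ t) (w t))
    simp only [map_neg, _root_.add_apply, _root_.neg_apply, _root_.smul_apply, smul_eq_mul, id,
      chartVelocity] at h2 h3 h4 ⊢
    -- `h3` replaces the second derivative of f in the chart by the Hessian, `h2` is the equation
    -- for w tested on the Christoffel vector Γ(w,γ̇), and `h4` moves Γ to the other slot of the
    -- Hessian.
    linear_combination (-2) * h3 - 2 * h2 - h4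

end AlongGeodesics

/-! ### Pointwise consequences of self-concordance -/

section PointwiseForms

variable {E : Type*} [NormedAddCommGroup E] [NormedSpace ℝ E] [FiniteDimensional ℝ E]
  {M : Type*} [TopologicalSpace M] [ChartedSpace E M] [IsManifold 𝓘(ℝ, E) ∞ M]
  (cov : CovariantDerivative 𝓘(ℝ, E) E (TangentSpace 𝓘(ℝ, E) : M → Type _))
  {C : Set M} (hC : IsOpen C) {f : M → ℝ} {σ : ℝ} (hf : IsSelfConcordant cov C f σ)
include hC hf

lemma chartHessian_pos {x : M} (hx : x ∈ C) (u : E) (hu : u ≠ 0) :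
    0 < chartHessian cov f x (extChartAt 𝓘(ℝ, E) x x) u u := by
  have hs := mem_chart_source E x
  have h := hf.nondegenerate x hx (ofChart x x u) (fun h0 => hu (by
    rw [← toChart_ofChart hs u, h0, map_zero]))
  rwa [hessian_eq cov hC hf.smooth hs hx, toChart_ofChart hs] at h

lemma hessian_self_nonneg {x : M} (hx : x ∈ C) (u : TangentSpace 𝓘(ℝ, E) x) :
    0 ≤ hessian cov f x u u := by
  rw [hessian_eq cov hC hf.smooth (mem_chart_source E x) hx]
  rcases eq_or_ne (toChart x x u) 0 with h | h
  · simp [h]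
  · exact (chartHessian_pos cov hC hf hx _ h).le

lemma exists_hessian_eq {x : M} (hx : x ∈ C) (c : ℝ) (u : TangentSpace 𝓘(ℝ, E) x) :
    ∃ w : TangentSpace 𝓘(ℝ, E) x, ∀ v,
      hessian cov f x w v = differential f x v + c * hessian cov f x u v := by
  have hs := mem_chart_source E x
  obtain ⟨e, he⟩ := exists_equiv_of_pos (chartHessian_pos cov hC hf hx)
  set q := extChartAt 𝓘(ℝ, E) x x
  set L := fderiv ℝ (inChart f x) q + c • chartHessian cov f x q (toChart x x u)
  refine ⟨ofChart x x (e.symm L), fun v => ?_⟩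
  rw [hessian_eq cov hC hf.smooth hs hx, hessian_eq cov hC hf.smooth hs hx,
    differential_eq hC hf.smooth hs hx, toChart_ofChart hs, ← he, ContinuousLinearEquiv.coe_coe,
    e.apply_symm_apply]
  simp only [L, ← he]
  rfl

lemma newtonDirection_spec {x : M} (hx : x ∈ C) (v : TangentSpace 𝓘(ℝ, E) x) :
    differential f x v + hessian cov f x (newtonDirection cov f x) v = 0 := by
  have h : ∃ u : TangentSpace 𝓘(ℝ, E) x, ∀ v : TangentSpace 𝓘(ℝ, E) x,
      differential f x v + hessian cov f x u v = 0 := by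
    have hs := mem_chart_source E x
    obtain ⟨w, hw⟩ := exists_hessian_eq cov hC hf hx 0 0
    refine ⟨-w, fun v => ?_⟩
    have h1 := hw v
    rw [hessian_eq cov hC hf.smooth hs hx] at h1 ⊢
    simp only [map_neg, _root_.neg_apply] at h1 ⊢
    linarith
  rw [newtonDirection, dif_pos h]
  exact h.choose_spec v

lemma newtonDecrement_nonneg (x : M) : 0 ≤ newtonDecrement cov f x := Real.sqrt_nonneg _

variable [T2Space M] (hsmooth : CovariantDerivative.ContMDiffCovariantDerivative cov ∞)
    (htorsion : ∀ (X Y : (x : M) → TangentSpace 𝓘(ℝ, E) x),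
      ContMDiff 𝓘(ℝ, E) 𝓘(ℝ, E).tangent ∞ (fun x => (⟨x, X x⟩ : TangentBundle 𝓘(ℝ, E) M)) →
      ContMDiff 𝓘(ℝ, E) 𝓘(ℝ, E).tangent ∞ (fun x => (⟨x, Y x⟩ : TangentBundle 𝓘(ℝ, E) M)) →
      ∀ x, cov Y x (X x) - cov X x (Y x) = VectorField.mlieBracket 𝓘(ℝ, E) X Y x)
include htorsion

lemma abs_hessian_le {x : M} (hx : x ∈ C) (u v : TangentSpace 𝓘(ℝ, E) x) :
    |hessian cov f x u v| ≤ √(hessian cov f x u u) * √(hessian cov f x v v) := by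
  have hs := mem_chart_source E x
  have hsymm := chartHessian_symm cov hC hf.smooth htorsion hs hx
  have h := abs_bilin_le (K := 1) hsymm hsymm (chartHessian_pos cov hC hf hx) (by
    intro u
    rw [one_mul, abs_of_nonneg]
    rcases eq_or_ne u 0 with h | h
    · simp [h]
    · exact (chartHessian_pos cov hC hf hx _ h).le) (toChart x x u) (toChart x x v)
  rwa [one_mul, ← hessian_eq cov hC hf.smooth hs hx, ← hessian_eq cov hC hf.smooth hs hx,
    ← hessian_eq cov hC hf.smooth hs hx] at h

include hsmooth

/-- For fixed w, the form ∇_w Hf is symmetric and dominated on the diagonal by Hf, so `abs_bilin_le`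
applies with K = 2σ√(Hf(w,w)). Only symmetry in the last two arguments is needed. -/
lemma abs_nablaHessian_le {x : M} (hx : x ∈ C) (w u v : TangentSpace 𝓘(ℝ, E) x) :
    |nablaHessian cov f x w u v| ≤ 2 * σ * √(hessian cov f x w w) *
      (√(hessian cov f x u u) * √(hessian cov f x v v)) := by
  have hs := mem_chart_source E x
  have hsymm := chartHessian_symm cov hC hf.smooth htorsion hs hx
  set q := extChartAt 𝓘(ℝ, E) x x
  set H := chartHessian cov f x q
  set Γ := (christoffel cov x q).flip (toChart x x w)
  set B : E →L[ℝ] E →L[ℝ] ℝ := fderiv ℝ (chartHessian cov f x) q (toChart x x w) -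
    H.comp Γ - (H.flip.comp Γ).flip with hB
  have hBapp : ∀ a b : TangentSpace 𝓘(ℝ, E) x,
      nablaHessian cov f x w a b = B (toChart x x a) (toChart x x b) := fun a b => by
    rw [nablaHessian_eq cov hC hf.smooth hsmooth hs hx]
    rfl
  have hBsymm : ∀ a b, B a b = B b a := by
    intro a b
    have h1 := fderiv_chartHessian_symm cov hC hf.smooth hsmooth htorsion hs hx (toChart x x w) a b
    simp only [hB, _root_.sub_apply, ContinuousLinearMap.comp_apply, ContinuousLinearMap.flip_apply]
    rw [h1, hsymm (Γ a) b, hsymm a (Γ b)]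
    ring
  have h := abs_bilin_le (K := 2 * σ * √(hessian cov f x w w)) hBsymm hsymm
    (chartHessian_pos cov hC hf hx) (by
      intro a
      have h1 := hf.bound x hx (ofChart x x a) w
      rwa [hBapp, hessian_eq cov hC hf.smooth hs hx (ofChart x x a), toChart_ofChart hs] at h1)
    (toChart x x u) (toChart x x v)
  rwa [← hBapp, ← hessian_eq cov hC hf.smooth hs hx, ← hessian_eq cov hC hf.smooth hs hx] at h

end PointwiseForms

/-! ### The Newton geodesic stays in C, and the decrement at its end -/

section NewtonGeodesic

variable {E : Type*} [NormedAddCommGroup E] [NormedSpace ℝ E] [FiniteDimensional ℝ E]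
  {M : Type*} [TopologicalSpace M] [ChartedSpace E M] [IsManifold 𝓘(ℝ, E) ∞ M] [T2Space M]
  (cov : CovariantDerivative 𝓘(ℝ, E) E (TangentSpace 𝓘(ℝ, E) : M → Type _))
  (hsmooth : CovariantDerivative.ContMDiffCovariantDerivative cov ∞)
  {C : Set M} (hC : IsOpen C) {f : M → ℝ} {σ : ℝ} (hf : IsSelfConcordant cov C f σ)
  {γ : ℝ → M} (hγ : IsGeodesicOn cov γ (Icc 0 1))
include hsmooth hC hf hγ

lemma abs_sqrt_hessian_sub_le {b : ℝ} (hb : b ≤ 1) (hγC : ∀ t ∈ Icc 0 b, γ t ∈ C) {t : ℝ}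
    (ht : t ∈ Icc 0 b) :
    |√(hessian cov f (γ t) (velocity γ (Icc 0 1) t) (velocity γ (Icc 0 1) t)) -
      √(hessian cov f (γ 0) (velocity γ (Icc 0 1) 0) (velocity γ (Icc 0 1) 0))| ≤
    σ * t * (√(hessian cov f (γ t) (velocity γ (Icc 0 1) t) (velocity γ (Icc 0 1) t)) *
      √(hessian cov f (γ 0) (velocity γ (Icc 0 1) 0) (velocity γ (Icc 0 1) 0))) := by
  have hsub : Icc 0 b ⊆ Icc (0 : ℝ) 1 := Icc_subset_Icc_right hb
  exact abs_sqrt_sub_sqrt_le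
    (p := fun r => hessian cov f (γ r) (velocity γ (Icc 0 1) r) (velocity γ (Icc 0 1) r))
    hf.sigma_nonneg
    (fun r hr => (hasDerivWithinAt_hessian_along cov hC hf.smooth (uniqueDiffOn_Icc zero_lt_one) hγ
      hsmooth (hsub hr) (hγC r hr)).mono hsub)
    (fun r hr => hessian_self_nonneg cov hC hf (hγC r hr) _)
    (fun r hr => hf.bound _ (hγC r hr) _ _) ht

lemma selfConcordantAlong (hγC : ∀ t ∈ Icc 0 1, γ t ∈ C) :
    SelfConcordantAlong (fun r => f (γ r))
      (fun r => differential (E := E) f (γ r) (velocity γ (Icc 0 1) r))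
      (fun r => hessian cov f (γ r) (velocity γ (Icc 0 1) r) (velocity γ (Icc 0 1) r)) σ where
  deriv t ht := hasDerivWithinAt_along cov hC hf.smooth hγ ht (hγC t ht)
  deriv₁ t ht := hasDerivWithinAt_differential_along cov hC hf.smooth
    (uniqueDiffOn_Icc zero_lt_one) hγ ht (hγC t ht)
  nonneg t ht := hessian_self_nonneg cov hC hf (hγC t ht) _
  bound _ ht := abs_sqrt_hessian_sub_le cov hsmooth hC hf hγ le_rfl hγC ht

lemma abs_sqrt_hessian_sub_le_right (hγC : ∀ t ∈ Icc 0 1, γ t ∈ C) :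
    ∀ t ∈ Icc (0 : ℝ) 1,
    |√(hessian cov f (γ (1 - t)) (velocity γ (Icc 0 1) (1 - t)) (velocity γ (Icc 0 1) (1 - t))) -
      √(hessian cov f (γ 1) (velocity γ (Icc 0 1) 1) (velocity γ (Icc 0 1) 1))| ≤
    σ * t * (√(hessian cov f (γ (1 - t)) (velocity γ (Icc 0 1) (1 - t))
      (velocity γ (Icc 0 1) (1 - t))) *
      √(hessian cov f (γ 1) (velocity γ (Icc 0 1) 1) (velocity γ (Icc 0 1) 1))) := fun _ ht =>
  abs_sqrt_sub_sqrt_le_right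
    (p := fun r => hessian cov f (γ r) (velocity γ (Icc 0 1) r) (velocity γ (Icc 0 1) r))
    hf.sigma_nonneg
    (fun r hr => hasDerivWithinAt_hessian_along cov hC hf.smooth (uniqueDiffOn_Icc zero_lt_one) hγ
      hsmooth hr (hγC r hr))
    (fun r hr => hessian_self_nonneg cov hC hf (hγC r hr) _)
    (fun r hr => hf.bound _ (hγC r hr) _ _) ht

variable {l : ℝ}
  (hl : l = √(hessian cov f (γ 0) (velocity γ (Icc 0 1) 0) (velocity γ (Icc 0 1) 0)))
  (hσl : σ * l < 1) (h0 : γ 0 ∈ C)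
include hl hσl h0

/-- Suppose T is the first time outside C. Before T, p ≤ (l/(1-σl))², so f is bounded along γ by
some Y. The points (γ(t), Y) then lie in the epigraph and converge to (γ(T), Y), which contradicts
its closedness. -/
lemma forall_mem_of_sigma_mul_lt_one : ∀ t ∈ Icc (0 : ℝ) 1, γ t ∈ C := by
  have hl0 : 0 ≤ l := hl ▸ Real.sqrt_nonneg _
  have hσ := hf.sigma_nonneg
  by_contra! hcon
  set S := Icc (0 : ℝ) 1 ∩ γ ⁻¹' Cᶜ
  have hS : IsCompact S := isCompact_Icc.of_isClosed_subset
    (hγ.1.continuousOn.preimage_isClosed_of_isClosed isClosed_Icc hC.isClosed_compl)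
    inter_subset_left
  obtain ⟨T, hT, hTmin⟩ := hS.exists_isLeast (by
    obtain ⟨t, ht, htC⟩ := hcon
    exact ⟨t, ht, htC⟩)
  have hT0 : 0 < T := hT.1.1.lt_of_ne (by
    rintro rfl
    exact hT.2 h0)
  have hpre : ∀ t ∈ Ico 0 T, γ t ∈ C := by
    intro t ht
    by_contra htC
    exact (hTmin ⟨⟨ht.1, ht.2.le.trans hT.1.2⟩, htC⟩).not_gt ht.2
  set P := (l / (1 - σ * l)) ^ 2
  set Y := f (γ 0) + |differential (E := E) f (γ 0) (velocity γ (Icc 0 1) 0)| + P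
  have hbound : ∀ b ∈ Ico 0 T, f (γ b) ≤ Y := by
    intro b hb
    have hb1 : b ≤ 1 := hb.2.le.trans hT.1.2
    have hsub : Icc 0 b ⊆ Icc (0 : ℝ) 1 := Icc_subset_Icc_right hb1
    have hbC : ∀ t ∈ Icc 0 b, γ t ∈ C := fun t ht => hpre t ⟨ht.1, ht.2.trans_lt hb.2⟩
    have h := abs_sub_le_of_second_deriv_le (P := P) hb1 (by positivity)
      (fun t ht => (hasDerivWithinAt_along cov hC hf.smooth hγ (hsub ht) (hbC t ht)).mono hsub)
      (fun t ht => (hasDerivWithinAt_differential_along cov hC hf.smooth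
        (uniqueDiffOn_Icc zero_lt_one) hγ (hsub ht) (hbC t ht)).mono hsub) (by
      intro t ht
      have h1 := abs_sqrt_hessian_sub_le cov hsmooth hC hf hγ hb1 hbC ht
      rw [← hl] at h1
      have h2 := hessian_self_nonneg cov hC hf (hbC t ht) (velocity γ (Icc 0 1) t)
      rw [abs_of_nonneg h2]
      rw [← Real.sq_sqrt h2]
      set r := √(hessian cov f (γ t) (velocity γ (Icc 0 1) t) (velocity γ (Icc 0 1) t))
      have hr : 0 ≤ r := Real.sqrt_nonneg _
      refine pow_le_pow_left₀ hr ?_ 2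
      rw [le_div_iff₀ (by linarith)]
      have h3 : σ * t * (r * l) ≤ σ * (r * l) :=
        mul_le_mul_of_nonneg_right (mul_le_of_le_one_right hσ (ht.2.trans hb1)) (by positivity)
      linarith [(abs_le.1 h1).2]) (right_mem_Icc.2 hb.1)
    linarith [(abs_le.1 h).2]
  have hcont : ContinuousWithinAt (fun t => (γ t, Y)) (Ico 0 T) T :=
    ((hγ.1.continuousOn T hT.1).mono fun t ht => ⟨ht.1, ht.2.le.trans hT.1.2⟩).prodMk
      continuousWithinAt_const
  have hmem := hcont.mem_closure (by rw [closure_Ico hT0.ne]; exact right_mem_Icc.2 hT0.le)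
    (t := {p : M × ℝ | p.1 ∈ C ∧ f p.1 ≤ p.2}) (fun t ht => ⟨hpre t ht, hbound t ht⟩)
  rw [hf.closed_epigraph.closure_eq] at hmem
  exact hT.2 hmem.1

variable (htorsion : ∀ (X Y : (x : M) → TangentSpace 𝓘(ℝ, E) x),
      ContMDiff 𝓘(ℝ, E) 𝓘(ℝ, E).tangent ∞ (fun x => (⟨x, X x⟩ : TangentBundle 𝓘(ℝ, E) M)) →
      ContMDiff 𝓘(ℝ, E) 𝓘(ℝ, E).tangent ∞ (fun x => (⟨x, Y x⟩ : TangentBundle 𝓘(ℝ, E) M)) →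
      ∀ x, cov Y x (X x) - cov X x (Y x) = VectorField.mlieBracket 𝓘(ℝ, E) X Y x)
include htorsion

lemma newtonDecrement_end_le (hN : ∀ v, differential f (γ 0) v +
      hessian cov f (γ 0) (velocity γ (Icc 0 1) 0) v = 0) :
    newtonDecrement cov f (γ 1) ≤ σ * l ^ 2 / (1 - σ * l) ^ 2 := by
  have hl0 : 0 ≤ l := hl ▸ Real.sqrt_nonneg _
  have hσ := hf.sigma_nonneg
  have hγC := forall_mem_of_sigma_mul_lt_one cov hsmooth hC hf hγ hl hσl h0
  -- The vector is defined for all r so that it can be chosen as a function; outside [0,1] it is an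
  -- irrelevant 0.
  have hw : ∀ r, ∃ w : TangentSpace 𝓘(ℝ, E) (γ r), r ∈ Icc (0 : ℝ) 1 → ∀ v,
      hessian cov f (γ r) w v =
        differential f (γ r) v + (1 - r) * hessian cov f (γ r) (velocity γ (Icc 0 1) r) v := by
    intro r
    by_cases hr : r ∈ Icc (0 : ℝ) 1
    · obtain ⟨w, hw⟩ := exists_hessian_eq cov hC hf (hγC r hr) (1 - r) (velocity γ (Icc 0 1) r)
      exact ⟨w, fun _ => hw⟩
    · exact ⟨0, fun h => absurd h hr⟩
  choose w hw using hw
  have h01 : (0 : ℝ) ∈ Icc (0 : ℝ) 1 := left_mem_Icc.2 zero_le_one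
  have h11 : (1 : ℝ) ∈ Icc (0 : ℝ) 1 := right_mem_Icc.2 zero_le_one
  have hmain := sqrt_le_of_newton_ode
    (G := fun r => hessian cov f (γ r) (w r) (w r))
    (p := fun r => hessian cov f (γ r) (velocity γ (Icc 0 1) r) (velocity γ (Icc 0 1) r))
    hσ hl0 hσl
    (fun t ht => hasDerivWithinAt_residual_along cov hC hf.smooth (uniqueDiffOn_Icc zero_lt_one) hγ
      hsmooth htorsion hf.nondegenerate hw ht (hγC t ht))
    (by
      have h := hw 0 h01 (w 0)
      rw [sub_zero, one_mul, hN] at h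
      exact h)
    (fun t ht => hessian_self_nonneg cov hC hf (hγC t ht) _)
    (fun t ht => hessian_self_nonneg cov hC hf (hγC t ht) _)
    (by
      intro t ht
      have h1 := abs_sqrt_hessian_sub_le cov hsmooth hC hf hγ le_rfl hγC ht
      rw [← hl] at h1
      linarith [(abs_le.1 h1).2])
    (by
      intro t ht
      have h1 := abs_nablaHessian_le cov hC hf hsmooth htorsion (hγC t ht)
        (velocity γ (Icc 0 1) t) (velocity γ (Icc 0 1) t) (w t)
      have h2 := hf.bound _ (hγC t ht) (w t) (velocity γ (Icc 0 1) t)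
      have h3 := Real.mul_self_sqrt (hessian_self_nonneg cov hC hf (hγC t ht)
        (velocity γ (Icc 0 1) t))
      have h4 : 0 ≤ 1 - t := by linarith [ht.2]
      have h5 := mul_le_mul_of_nonneg_left ((le_abs_self _).trans h1) h4
      have h6 := (neg_le_abs _).trans h2
      set r := √(hessian cov f (γ t) (velocity γ (Icc 0 1) t) (velocity γ (Icc 0 1) t))
      rw [← h3]
      linarith)
  -- At t = 1 the residual is Df, so w(1) is minus the Newton direction. Testing the two defining
  -- equations on each other's solutions is enough to compare the norms.
  have hlam : newtonDecrement cov f (γ 1) = √(hessian cov f (γ 1) (w 1) (w 1)) := by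
    have hw1 := hw 1 h11
    simp only [sub_self, zero_mul, add_zero] at hw1
    have hN1 := newtonDirection_spec cov hC hf (hγC 1 h11)
    have h1 := hN1 (newtonDirection cov f (γ 1))
    have h2 := hN1 (w 1)
    have h3 := hw1 (newtonDirection cov f (γ 1))
    have h4 := hw1 (w 1)
    have h5 := hessian_symm cov hC hf.smooth htorsion (hγC 1 h11) (w 1)
      (newtonDirection cov f (γ 1))
    rw [newtonDecrement]
    congr 1
    linarith
  rw [hlam]
  exact hmain

end NewtonGeodesic

/-! ### Continuous dependence on initial data for an equation given in charts -/

section FlowContinuity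

variable {N : Type*} [TopologicalSpace N] {G : Type*} [NormedAddCommGroup G] [NormedSpace ℝ G]

/-- In the chart `Φ`, the curve `c : [0,1] → N` satisfies the differential equation `z' = F z`. -/
def SolvesInChart (Φ : OpenPartialHomeomorph N G) (F : G → G) (c : ℝ → N) : Prop :=
  ∀ t ∈ Icc (0 : ℝ) 1, c t ∈ Φ.source →
    HasDerivWithinAt (fun r => Φ (c r)) (F (Φ (c t))) (Icc 0 1) t

variable {Φ : OpenPartialHomeomorph N G} {F : G → G} {K : NNReal} {U : Set G} {c g : ℝ → N}
  {a b : ℝ}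

/-- Grönwall in a single chart; the exponent is at most K because the time interval lies in [0,1].
-/
lemma SolvesInChart.dist_le (hU : LipschitzOnWith K F U) (hc : SolvesInChart Φ F c)
    (hg : SolvesInChart Φ F g) (ha : 0 ≤ a) (hb : b ≤ 1)
    (hcU : ∀ t ∈ Icc a b, c t ∈ Φ.source ∧ Φ (c t) ∈ U)
    (hgU : ∀ t ∈ Icc a b, g t ∈ Φ.source ∧ Φ (g t) ∈ U) {t : ℝ} (ht : t ∈ Icc a b) :
    dist (Φ (g t)) (Φ (c t)) ≤ dist (Φ (g a)) (Φ (c a)) * Real.exp K := by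
  have hsub : Icc a b ⊆ Icc (0 : ℝ) 1 := Icc_subset_Icc ha hb
  have hder : ∀ {c : ℝ → N}, SolvesInChart Φ F c →
      (∀ t ∈ Icc a b, c t ∈ Φ.source ∧ Φ (c t) ∈ U) → ∀ t ∈ Ico a b,
      HasDerivWithinAt (fun r => Φ (c r)) (F (Φ (c t))) (Ici t) t := fun hc hcU t ht =>
    (hc t (hsub ⟨ht.1, ht.2.le⟩) (hcU t ⟨ht.1, ht.2.le⟩).1).mono_of_mem_nhdsWithin
      (mem_of_superset (Icc_mem_nhdsGE (ht.2.trans_le hb)) (Icc_subset_Icc_left (ha.trans ht.1)))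
  have hcont : ∀ {c : ℝ → N}, SolvesInChart Φ F c →
      (∀ t ∈ Icc a b, c t ∈ Φ.source ∧ Φ (c t) ∈ U) →
      ContinuousOn (fun r => Φ (c r)) (Icc a b) := fun hc hcU t ht =>
    (hc t (hsub ht) (hcU t ht).1).continuousWithinAt.mono hsub
  refine (dist_le_of_trajectories_ODE_of_mem (v := fun _ => F) (s := fun _ => U) (fun _ _ => hU)
    (hcont hg hgU) (hder hg hgU) (fun t ht => (hgU t ⟨ht.1, ht.2.le⟩).2)
    (hcont hc hcU) (hder hc hcU) (fun t ht => (hcU t ⟨ht.1, ht.2.le⟩).2) le_rfl t ht).trans ?_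
  refine mul_le_mul_of_nonneg_left (Real.exp_le_exp.2 ?_) dist_nonneg
  exact mul_le_of_le_one_right K.2 (by linarith [ht.2])

variable [T2Space N] [ProperSpace G]

/-- A first-exit argument. Up to the exit time T, Grönwall keeps g within a radius r' < r in the
chart, and this must persist at T. -/
lemma SolvesInChart.mem_of_dist_lt {z₀ : G} {r : ℝ} (hr : Metric.closedBall z₀ r ⊆ Φ.target)
    (hF : LipschitzOnWith K F (Metric.ball z₀ r)) (hc : SolvesInChart Φ F c)
    (hg : SolvesInChart Φ F g) (hgcont : ContinuousOn g (Icc 0 1)) (ha : 0 ≤ a) (hb : b ≤ 1)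
    (hcU : ∀ t ∈ Icc a b, c t ∈ Φ.source ∧ Φ (c t) ∈ Metric.ball z₀ (r / 2))
    (hga : g a ∈ Φ.source) (hd : dist (Φ (g a)) (Φ (c a)) * Real.exp K < r / 2) :
    ∀ t ∈ Icc a b, g t ∈ Φ.source ∧ Φ (g t) ∈ Metric.ball z₀ r := by
  have hsub : Icc a b ⊆ Icc (0 : ℝ) 1 := Icc_subset_Icc ha hb
  by_contra! hcon
  obtain ⟨s, hs, hsbad⟩ := hcon
  have hab : a ≤ b := hs.1.trans hs.2
  set V := Φ.source ∩ Φ ⁻¹' Metric.ball z₀ r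
  have hV : IsOpen V := Φ.isOpen_inter_preimage Metric.isOpen_ball
  set S := Icc a b ∩ g ⁻¹' Vᶜ
  have hS : IsCompact S := isCompact_Icc.of_isClosed_subset
    ((hgcont.mono hsub).preimage_isClosed_of_isClosed isClosed_Icc hV.isClosed_compl)
    inter_subset_left
  obtain ⟨T, hT, hTmin⟩ := hS.exists_isLeast ⟨s, hs, fun h => hsbad h.1 h.2⟩
  have hexp : 1 ≤ Real.exp K := Real.one_le_exp K.2
  have hr0 : 0 ≤ dist (Φ (g a)) (Φ (c a)) := dist_nonneg
  have hrp : 0 < r := by nlinarith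
  have hcU' : ∀ t ∈ Icc a b, c t ∈ Φ.source ∧ Φ (c t) ∈ Metric.ball z₀ r := fun t ht =>
    ⟨(hcU t ht).1, Metric.ball_subset_ball (by linarith) (hcU t ht).2⟩
  have haV : g a ∈ V := by
    refine ⟨hga, ?_⟩
    have h1 := Metric.mem_ball.1 (hcU a ⟨le_rfl, hab⟩).2
    have h2 := dist_triangle (Φ (g a)) (Φ (c a)) z₀
    rw [mem_preimage, Metric.mem_ball]
    nlinarith
  have hTa : a < T := hT.1.1.lt_of_ne (by
    rintro rfl
    exact hT.2 haV)
  have hpre : ∀ t ∈ Ico a T, g t ∈ V := by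
    intro t ht
    by_contra htV
    exact (hTmin ⟨⟨ht.1, ht.2.le.trans hT.1.2⟩, htV⟩).not_gt ht.2
  set r' := r / 2 + dist (Φ (g a)) (Φ (c a)) * Real.exp K
  have hr' : r' < r := by simp only [r']; linarith
  -- A limit of points of the chart domain could leave that domain. The preimage of the closed ball
  -- is compact, hence closed in the Hausdorff space N, so g(T) remains inside.
  have hB : IsCompact (Φ.symm '' Metric.closedBall z₀ r') :=
    (isCompact_closedBall z₀ r').image_of_continuousOn (Φ.continuousOn_symm.mono
      ((Metric.closedBall_subset_closedBall hr'.le).trans hr))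
  have hin : ∀ t ∈ Ico a T, g t ∈ Φ.symm '' Metric.closedBall z₀ r' := by
    intro t ht
    have htb : t ≤ b := ht.2.le.trans hT.1.2
    have h1 := SolvesInChart.dist_le hF hc hg ha (htb.trans hb)
      (fun s hs => hcU' s ⟨hs.1, hs.2.trans htb⟩)
      (fun s hs => hpre s ⟨hs.1, hs.2.trans_lt ht.2⟩) (right_mem_Icc.2 ht.1)
    have h2 := Metric.mem_ball.1 (hcU t ⟨ht.1, htb⟩).2
    have h3 := dist_triangle (Φ (g t)) (Φ (c t)) z₀
    refine ⟨Φ (g t), ?_, Φ.left_inv (hpre t ht).1⟩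
    rw [Metric.mem_closedBall]
    simp only [r']
    linarith
  have hcont : ContinuousWithinAt g (Ico a T) T :=
    (hgcont T (hsub hT.1)).mono fun t ht => hsub ⟨ht.1, ht.2.le.trans hT.1.2⟩
  have hmem := hcont.mem_closure (by rw [closure_Ico hTa.ne]; exact right_mem_Icc.2 hTa.le) hin
  rw [hB.isClosed.closure_eq] at hmem
  obtain ⟨z, hz, hzT⟩ := hmem
  have hzt : z ∈ Φ.target := hr (Metric.closedBall_subset_closedBall hr'.le hz)
  refine hT.2 ⟨hzT ▸ Φ.map_target hzt, ?_⟩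
  rw [mem_preimage, ← hzT, Φ.right_inv hzt]
  exact Metric.closedBall_subset_ball hr' hz

variable {ι : Type*} {l : Filter ι} {g : ι → ℝ → N}

lemma SolvesInChart.exists_tendsto (hF : ContDiffOn ℝ 1 F Φ.target) (hc : SolvesInChart Φ F c)
    (hccont : ContinuousOn c (Icc 0 1)) (hg : ∀ i, SolvesInChart Φ F (g i))
    (hgcont : ∀ i, ContinuousOn (g i) (Icc 0 1)) {t₀ : ℝ} (ht₀ : t₀ ∈ Icc (0 : ℝ) 1)
    (h₀ : c t₀ ∈ Φ.source) :
    ∃ ε > 0, ∀ a b, 0 ≤ a → b ≤ 1 → a ≤ b → a ∈ Metric.ball t₀ ε → b ∈ Metric.ball t₀ ε →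
      Tendsto (fun i => g i a) l (𝓝 (c a)) → Tendsto (fun i => g i b) l (𝓝 (c b)) := by
  have hz₀ := Φ.map_source h₀
  set z₀ := Φ (c t₀)
  have htar := Φ.open_target.mem_nhds hz₀
  obtain ⟨K, W, hW, hK⟩ := (hF.contDiffAt htar).exists_lipschitzOnWith
  obtain ⟨r, hr, hrsub⟩ := Metric.nhds_basis_closedBall.mem_iff.1 (inter_mem hW htar)
  have hKr : LipschitzOnWith K F (Metric.ball z₀ r) :=
    hK.mono fun z hz => (hrsub (Metric.ball_subset_closedBall hz)).1
  have hV : IsOpen (Φ.source ∩ Φ ⁻¹' Metric.ball z₀ (r / 2)) :=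
    Φ.isOpen_inter_preimage Metric.isOpen_ball
  have hev := (hccont t₀ ht₀).preimage_mem_nhdsWithin
    (hV.mem_nhds ⟨h₀, Metric.mem_ball_self (by positivity)⟩)
  obtain ⟨ε, hε, hεsub⟩ := Metric.mem_nhdsWithin_iff.1 hev
  refine ⟨ε, hε, fun a b ha hb hab haε hbε hlim => ?_⟩
  have hcU : ∀ t ∈ Icc a b, c t ∈ Φ.source ∧ Φ (c t) ∈ Metric.ball z₀ (r / 2) := by
    intro t ht
    refine hεsub ⟨?_, ha.trans ht.1, ht.2.trans hb⟩
    exact ((convex_ball t₀ ε).ordConnected).out haε hbε ht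
  have hca := hcU a ⟨le_rfl, hab⟩
  have hcb := hcU b ⟨hab, le_rfl⟩
  have hΦa : Tendsto (fun i => Φ (g i a)) l (𝓝 (Φ (c a))) :=
    (Φ.continuousAt hca.1).tendsto.comp hlim
  have hdist : Tendsto (fun i => dist (Φ (g i a)) (Φ (c a)) * Real.exp K) l (𝓝 0) := by
    simpa using (tendsto_iff_dist_tendsto_zero.1 hΦa).mul_const (Real.exp K)
  have hgood : ∀ᶠ i in l, g i b ∈ Φ.source ∧
      dist (Φ (g i b)) (Φ (c b)) ≤ dist (Φ (g i a)) (Φ (c a)) * Real.exp K := by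
    filter_upwards [hlim.eventually (Φ.open_source.mem_nhds hca.1),
      hdist.eventually_lt_const (show (0 : ℝ) < r / 2 by positivity)] with i hi1 hi2
    have hgU := SolvesInChart.mem_of_dist_lt (fun z hz => (hrsub hz).2) hKr hc (hg i) (hgcont i)
      ha hb hcU hi1 hi2
    refine ⟨(hgU b ⟨hab, le_rfl⟩).1, SolvesInChart.dist_le hKr hc (hg i) ha hb
      (fun t ht => ⟨(hcU t ht).1, Metric.ball_subset_ball (by linarith) (hcU t ht).2⟩) hgU
      ⟨hab, le_rfl⟩⟩
  have hΦb : Tendsto (fun i => Φ (g i b)) l (𝓝 (Φ (c b))) := by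
    rw [tendsto_iff_dist_tendsto_zero]
    exact squeeze_zero' (Eventually.of_forall fun _ => dist_nonneg)
      (hgood.mono fun i hi => hi.2) hdist
  have hfin := (Φ.continuousAt_symm (Φ.map_source hcb.1)).tendsto.comp hΦb
  rw [Φ.left_inv hcb.1] at hfin
  exact hfin.congr' (hgood.mono fun i hi => Φ.left_inv hi.1)

/-- Near each time, convergence propagates within one chart around c. A finite subdivision of [0,1]
subordinate to these neighbourhoods carries it from 0 to 1. -/
lemma tendsto_of_forall_solvesInChart (hccont : ContinuousOn c (Icc 0 1))
    (hgcont : ∀ i, ContinuousOn (g i) (Icc 0 1))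
    (hloc : ∀ t ∈ Icc (0 : ℝ) 1, ∃ (Φ : OpenPartialHomeomorph N G) (F : G → G), c t ∈ Φ.source ∧
      ContDiffOn ℝ 1 F Φ.target ∧ SolvesInChart Φ F c ∧ ∀ i, SolvesInChart Φ F (g i))
    (hlim : Tendsto (fun i => g i 0) l (𝓝 (c 0))) :
    Tendsto (fun i => g i 1) l (𝓝 (c 1)) := by
  have hstep : ∀ t : Icc (0 : ℝ) 1, ∃ ε > 0, ∀ a b, 0 ≤ a → b ≤ 1 → a ≤ b →
      a ∈ Metric.ball (t : ℝ) ε → b ∈ Metric.ball (t : ℝ) ε →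
      Tendsto (fun i => g i a) l (𝓝 (c a)) → Tendsto (fun i => g i b) l (𝓝 (c b)) := by
    intro t
    obtain ⟨Φ, F, h₀, hF, hc, hg⟩ := hloc t t.2
    exact SolvesInChart.exists_tendsto hF hc hccont hg hgcont t.2 h₀
  choose ε hε hstep using hstep
  obtain ⟨τ, hτ0, hτmono, ⟨m, hm⟩, hτ⟩ := exists_monotone_Icc_subset_open_cover_Icc
    (zero_le_one (α := ℝ)) (c := fun t : Icc (0 : ℝ) 1 => Metric.ball t (ε t))
    (fun _ => Metric.isOpen_ball)
    (fun t _ => mem_iUnion.2 ⟨t, Metric.mem_ball_self (hε t)⟩)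
  have hall : ∀ n, Tendsto (fun i => g i (τ n)) l (𝓝 (c (τ n))) := by
    intro n
    induction n with
    | zero => rw [hτ0]; exact hlim
    | succ n ih =>
      obtain ⟨t, ht⟩ := hτ n
      have hle := hτmono n.le_succ
      exact hstep t _ _ (τ n).2.1 (τ (n + 1)).2.2 hle (ht (left_mem_Icc.2 hle))
        (ht (right_mem_Icc.2 hle)) ih
  have h := hall m
  rwa [hm m le_rfl] at h

end FlowContinuity

/-! ### Uniqueness and continuity of the exponential map -/

section GeodesicFlow

variable {E : Type*} [NormedAddCommGroup E] [NormedSpace ℝ E]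
  {M : Type*} [TopologicalSpace M] [ChartedSpace E M] [IsManifold 𝓘(ℝ, E) ∞ M]

instance [T2Space M] : T2Space (TangentBundle 𝓘(ℝ, E) M) := by
  rw [t2_iff_ultrafilter]
  intro p q u hp hq
  have hproj : p.1 = q.1 := by
    have hc := FiberBundle.continuous_proj E (TangentSpace 𝓘(ℝ, E) : M → Type _)
    have h1 : Tendsto (π E (TangentSpace 𝓘(ℝ, E) : M → Type _)) u (𝓝 p.1) :=
      (hc.tendsto p).mono_left hp
    have h2 : Tendsto (π E (TangentSpace 𝓘(ℝ, E) : M → Type _)) u (𝓝 q.1) :=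
      (hc.tendsto q).mono_left hq
    exact tendsto_nhds_unique h1 h2
  set e := trivializationAt E (TangentSpace 𝓘(ℝ, E) : M → Type _) p.1
  have hps : p ∈ e.source := FiberBundle.mem_trivializationAt_proj_source
  have hqs : q ∈ e.source := by
    rw [e.mem_source, ← hproj]
    exact e.mem_source.1 hps
  exact e.injOn hps hqs (tendsto_nhds_unique
    ((e.continuousAt hps).tendsto.mono_left hp)
    ((e.continuousAt hqs).tendsto.mono_left hq))

/-- The chart of the tangent bundle induced by the chart of `M` at `x₀`. -/
def tangentChart (x₀ : M) : OpenPartialHomeomorph (TangentBundle 𝓘(ℝ, E) M) (E × E) :=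
  (trivializationAt E (TangentSpace 𝓘(ℝ, E) : M → Type _) x₀).toOpenPartialHomeomorph.trans
    ((chartAt E x₀).prod (OpenPartialHomeomorph.refl E))

lemma mem_tangentChart_source {x₀ : M} {p : TangentBundle 𝓘(ℝ, E) M} :
    p ∈ (tangentChart x₀).source ↔ p.1 ∈ (chartAt E x₀).source := by
  simp [tangentChart]

lemma tangentChart_apply {x₀ y : M} (hy : y ∈ (chartAt E x₀).source)
    (v : TangentSpace 𝓘(ℝ, E) y) :
    tangentChart x₀ (⟨y, v⟩ : TangentBundle 𝓘(ℝ, E) M) =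
      (extChartAt 𝓘(ℝ, E) x₀ y, toChart x₀ y v) := by
  rw [← trivializationAt_snd hy]
  simp [tangentChart]

lemma tangentChart_target_subset (x₀ : M) :
    (tangentChart x₀).target ⊆ (extChartAt 𝓘(ℝ, E) x₀).target ×ˢ univ := by
  intro z hz
  simp only [tangentChart, OpenPartialHomeomorph.trans_target] at hz
  simpa using hz.1.1

/-- A curve together with its velocity. -/
def velocityLift (γ : ℝ → M) (s : Set ℝ) (t : ℝ) : TangentBundle 𝓘(ℝ, E) M :=
  ⟨γ t, velocity γ s t⟩

variable [FiniteDimensional ℝ E]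
  (cov : CovariantDerivative 𝓘(ℝ, E) E (TangentSpace 𝓘(ℝ, E) : M → Type _))

/-- The geodesic equation in the chart at `x₀`, as a first order equation. -/
def geodesicField (x₀ : M) (z : E × E) : E × E := (z.2, -christoffel cov x₀ z.1 z.2 z.2)

lemma contDiffOn_geodesicField [T2Space M]
    (hsmooth : CovariantDerivative.ContMDiffCovariantDerivative cov ∞)
    (x₀ : M) : ContDiffOn ℝ 1 (geodesicField cov x₀) (tangentChart x₀).target := by
  have h : ContDiffOn ℝ 1 (fun z : E × E => christoffel cov x₀ z.1) (tangentChart x₀).target :=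
    (((contDiffOn_christoffel cov hsmooth x₀).of_le (by simp)).comp contDiffOn_fst
      fun z hz => (tangentChart_target_subset x₀ hz).1)
  exact contDiffOn_snd.prodMk ((h.clm_apply contDiffOn_snd).clm_apply contDiffOn_snd).neg

variable {cov} {γ : ℝ → M}

lemma IsGeodesicOn.solvesInChart (hγ : IsGeodesicOn cov γ (Icc 0 1)) (x₀ : M) :
    SolvesInChart (tangentChart x₀) (geodesicField cov x₀)
      (velocityLift (E := E) γ (Icc 0 1)) := by
  intro t ht hs
  have hx : γ t ∈ (chartAt E x₀).source := mem_tangentChart_source.1 hs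
  have h := (hasDerivWithinAt_chart_curve hγ.1 ht hx).prodMk
    (hγ.hasDerivWithinAt_chartVelocity cov (uniqueDiffOn_Icc zero_lt_one) ht hx)
  rw [velocityLift, tangentChart_apply hx]
  refine h.congr_of_eventuallyEq_of_mem ?_ ht
  filter_upwards [eventually_mem_source (hγ.1.continuousOn t ht) hx] with r hr
  exact tangentChart_apply hr _

lemma IsGeodesicOn.continuousOn_velocityLift (hγ : IsGeodesicOn cov γ (Icc 0 1)) :
    ContinuousOn (velocityLift (E := E) γ (Icc 0 1)) (Icc 0 1) := by
  intro t ht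
  have hx := mem_chart_source E (γ t)
  rw [(tangentChart (γ t)).continuousWithinAt_iff_continuousWithinAt_comp_left
    (mem_tangentChart_source.2 hx)]
  · exact (hγ.solvesInChart (γ t) t ht (mem_tangentChart_source.2 hx)).continuousWithinAt
  · filter_upwards [eventually_mem_source (hγ.1.continuousOn t ht) hx] with r hr
    exact mem_tangentChart_source.2 hr

variable [T2Space M] (hsmooth : CovariantDerivative.ContMDiffCovariantDerivative cov ∞)
include hsmooth

lemma tendsto_geodesic_end {ι : Type*} {l : Filter ι} {g : ι → ℝ → M}
    (hγ : IsGeodesicOn cov γ (Icc 0 1)) (hg : ∀ i, IsGeodesicOn cov (g i) (Icc 0 1))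
    (h : Tendsto (fun i => velocityLift (E := E) (g i) (Icc 0 1) 0) l
      (𝓝 (velocityLift γ (Icc 0 1) 0))) :
    Tendsto (fun i => g i 1) l (𝓝 (γ 1)) := by
  have h1 := tendsto_of_forall_solvesInChart hγ.continuousOn_velocityLift
    (fun i => (hg i).continuousOn_velocityLift)
    (fun t _ => ⟨tangentChart (γ t), geodesicField cov (γ t),
      mem_tangentChart_source.2 (mem_chart_source E (γ t)),
      contDiffOn_geodesicField cov hsmooth _, hγ.solvesInChart _, fun i => (hg i).solvesInChart _⟩)
    h
  exact ((FiberBundle.continuous_proj E (TangentSpace 𝓘(ℝ, E) : M → Type _)).tendsto _).comp h1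

/-- Uniqueness is continuity for a constant family: equal initial velocities make the end point of
one geodesic converge to that of the other along the filter `pure ()`. -/
lemma IsExp.eq {x : M} {u : TangentSpace 𝓘(ℝ, E) x} {y z : M} (hy : IsExp cov x u y)
    (hz : IsExp cov x u z) : y = z := by
  obtain ⟨γ, hγ, hγ0, rfl⟩ := hy
  obtain ⟨g, hg, hg0, rfl⟩ := hz
  have h := tendsto_geodesic_end hsmooth hg (l := (pure () : Filter Unit)) (g := fun _ => γ)
    (fun _ => hγ) (by
      rw [velocityLift, velocityLift, hγ0, hg0]
      exact tendsto_const_nhds)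
  exact tendsto_nhds_unique tendsto_const_nhds h

omit hsmooth in
lemma isExp_expMap {x : M} {u : TangentSpace 𝓘(ℝ, E) x} (hexp : ∃ y, IsExp cov x u y) :
    IsExp cov x u (expMap cov x u) := by
  rw [expMap, dif_pos hexp]
  exact hexp.choose_spec

omit hsmooth in
lemma isExp_zero (x : M) : IsExp cov x 0 x := by
  have hv : ∀ t, velocity (E := E) (fun _ : ℝ => x) (Icc 0 1) t = 0 := by
    intro t
    rw [velocity, mfderivWithin_const]
    rfl
  refine ⟨fun _ => x, ⟨contMDiffOn_const, fun t ht => ?_⟩, ?_, rfl⟩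
  · have h : (fun r : ℝ => ((trivializationAt E (TangentSpace 𝓘(ℝ, E) : M → Type _) x)
        (⟨x, velocity (fun _ : ℝ => x) (Icc 0 1) r⟩ : TangentBundle 𝓘(ℝ, E) M)).2) =
        fun _ => 0 := by
      funext r
      rw [hv r, trivializationAt_snd (mem_chart_source E x), map_zero]
    rw [covDerivAlong, trivializationAt_symm (mem_chart_source E x), h, hv t, map_zero, add_zero,
      derivWithin_fun_const, Pi.zero_apply, map_zero]
  · rw [hv]

lemma expMap_zero (x : M) : expMap cov x 0 = x :=
  (isExp_expMap ⟨x, isExp_zero x⟩).eq hsmooth (isExp_zero x)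

lemma continuous_expMap {x : M} (hexp : ∀ u : TangentSpace 𝓘(ℝ, E) x, ∃ y, IsExp cov x u y) :
    Continuous (expMap cov x) := by
  choose g hg hg0 hg1 using fun u => isExp_expMap (hexp u)
  rw [continuous_iff_continuousAt]
  intro u
  have h := tendsto_geodesic_end hsmooth (hg u) hg (l := 𝓝 u) (by
    simp only [velocityLift, hg0]
    exact (FiberBundle.continuous_totalSpaceMk E (TangentSpace 𝓘(ℝ, E) : M → Type _) x).tendsto u)
  simp only [hg1] at h
  exact h

end GeodesicFlow

/-! ### The threshold (3 - √5)/2 and geometric decay -/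

section NewtonRate

/-- The condition s < (1-s)² is s² - 3s + 1 > 0, whose smaller root is (3-√5)/2. -/
lemma div_one_sub_sq_lt_one {s : ℝ} (h : s < (3 - √5) / 2) : s < 1 ∧ s / (1 - s) ^ 2 < 1 := by
  have h5 := Real.sq_sqrt (show (0 : ℝ) ≤ 5 by norm_num)
  have h1 : 2 ≤ √5 := Real.le_sqrt_of_sq_le (by norm_num)
  have hs : s < 1 := by linarith
  refine ⟨hs, ?_⟩
  rw [div_lt_one (by nlinarith)]
  nlinarith

variable {L : ℕ → ℝ} {σ : ℝ}

/-- Replacing one factor L k by L 0 in the quadratic estimate gives a linear rate θ < 1. -/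
lemma tendsto_zero_of_newton_rate (hσ : 0 ≤ σ) (hL : ∀ k, 0 ≤ L k) (h0 : σ * L 0 < (3 - √5) / 2)
    (hmono : ∀ k, L k ≤ L 0) (hstep : ∀ k, L (k + 1) ≤ σ / (1 - σ * L 0) ^ 2 * L k ^ 2) :
    Tendsto L atTop (𝓝 0) := by
  obtain ⟨h1, hθ⟩ := div_one_sub_sq_lt_one h0
  set θ := σ * L 0 / (1 - σ * L 0) ^ 2
  have hθ0 : 0 ≤ θ := div_nonneg (mul_nonneg hσ (hL 0)) (sq_nonneg _)
  have hle : ∀ k, L k ≤ θ ^ k * L 0 := by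
    intro k
    induction k with
    | zero => simp
    | succ k ih =>
      have h2 : σ / (1 - σ * L 0) ^ 2 * L k ^ 2 ≤ θ * L k := by
        have h3 : 0 ≤ σ / (1 - σ * L 0) ^ 2 := div_nonneg hσ (sq_nonneg _)
        calc _ = σ / (1 - σ * L 0) ^ 2 * L k * L k := by ring
          _ ≤ σ / (1 - σ * L 0) ^ 2 * L k * L 0 :=
            mul_le_mul_of_nonneg_left (hmono k) (mul_nonneg h3 (hL k))
          _ = _ := by simp only [θ]; ring
      calc L (k + 1) ≤ θ * L k := (hstep k).trans h2
        _ ≤ θ * (θ ^ k * L 0) := mul_le_mul_of_nonneg_left ih hθ0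
        _ = _ := by ring
  refine squeeze_zero hL hle ?_
  simpa using (tendsto_pow_atTop_nhds_zero_of_lt_one hθ0 hθ).mul_const (L 0)

end NewtonRate

/-! ### The Newton step, the minimizer and convergence of the iterates -/

section NewtonMethod

variable {E : Type*} [NormedAddCommGroup E] [NormedSpace ℝ E] [FiniteDimensional ℝ E]
  {M : Type*} [TopologicalSpace M] [T2Space M] [ChartedSpace E M] [IsManifold 𝓘(ℝ, E) ∞ M]
  {cov : CovariantDerivative 𝓘(ℝ, E) E (TangentSpace 𝓘(ℝ, E) : M → Type _)}
  {C : Set M} (hC : IsOpen C) {f : M → ℝ} {σ : ℝ} (hf : IsSelfConcordant cov C f σ)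
  (htorsion : ∀ (X Y : (x : M) → TangentSpace 𝓘(ℝ, E) x),
      ContMDiff 𝓘(ℝ, E) 𝓘(ℝ, E).tangent ∞ (fun x => (⟨x, X x⟩ : TangentBundle 𝓘(ℝ, E) M)) →
      ContMDiff 𝓘(ℝ, E) 𝓘(ℝ, E).tangent ∞ (fun x => (⟨x, Y x⟩ : TangentBundle 𝓘(ℝ, E) M)) →
      ∀ x, cov Y x (X x) - cov X x (Y x) = VectorField.mlieBracket 𝓘(ℝ, E) X Y x)
  (hsmooth : CovariantDerivative.ContMDiffCovariantDerivative cov ∞)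
  (hexp : ∀ (x : M) (u : TangentSpace 𝓘(ℝ, E) x), ∃ y, IsExp cov x u y)
  (hsurj : ∀ x : M, Function.Surjective (expMap cov x)) (hconv : GeodesicallyConvex cov C)
include hC hf

lemma exists_coercive_hessian {x : M} (hx : x ∈ C) :
    ∃ c > 0, ∀ u : TangentSpace 𝓘(ℝ, E) x, c * ‖toChart x x u‖ ≤ √(hessian cov f x u u) := by
  obtain ⟨c, hc, h⟩ := exists_coercive (chartHessian_pos cov hC hf hx)
  refine ⟨√c, Real.sqrt_pos.2 hc, fun u => Real.le_sqrt_of_sq_le ?_⟩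
  rw [hessian_eq cov hC hf.smooth (mem_chart_source E x) hx, mul_pow, Real.sq_sqrt hc.le]
  exact h _

include htorsion

lemma abs_differential_le {x : M} (hx : x ∈ C) (v : TangentSpace 𝓘(ℝ, E) x) :
    |differential f x v| ≤ newtonDecrement cov f x * √(hessian cov f x v v) := by
  have h1 := newtonDirection_spec cov hC hf hx v
  have h2 := abs_hessian_le cov hC hf htorsion hx (newtonDirection cov f x) v
  rw [show differential f x v = -hessian cov f x (newtonDirection cov f x) v by linarith, abs_neg]
  exact h2

include hsmooth hexp

lemma newtonStep_mem_and_newtonDecrement_le {x : M} (hx : x ∈ C)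
    (hlt : σ * newtonDecrement cov f x < 1) :
    newtonStep cov f x ∈ C ∧ newtonDecrement cov f (newtonStep cov f x) ≤
      σ * newtonDecrement cov f x ^ 2 / (1 - σ * newtonDecrement cov f x) ^ 2 := by
  obtain ⟨γ, hγ, hγ0, hγ1⟩ := isExp_expMap (hexp x (newtonDirection cov f x))
  have hl : newtonDecrement cov f x =
      √(hessian cov f (γ 0) (velocity γ (Icc 0 1) 0) (velocity γ (Icc 0 1) 0)) :=
    (congrArg (fun p : TangentBundle 𝓘(ℝ, E) M => √(hessian cov f p.1 p.2 p.2)) hγ0).symm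
  have h0 : γ 0 = x := congrArg (fun p : TangentBundle 𝓘(ℝ, E) M => p.1) hγ0
  have h0C : γ 0 ∈ C := h0 ▸ hx
  -- The initial data agree only as points of the tangent bundle, so the statement is generalized
  -- over such points before the equality is substituted.
  have hN : ∀ p : TangentBundle 𝓘(ℝ, E) M, p = ⟨x, newtonDirection cov f x⟩ →
      ∀ v : TangentSpace 𝓘(ℝ, E) p.1, differential f p.1 v + hessian cov f p.1 p.2 v = 0 := by
    rintro _ rfl v
    exact newtonDirection_spec cov hC hf hx v
  rw [newtonStep, ← hγ1]
  exact ⟨forall_mem_of_sigma_mul_lt_one cov hsmooth hC hf hγ hl hlt h0C 1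
    (right_mem_Icc.2 zero_le_one),
    newtonDecrement_end_le cov hsmooth hC hf hγ hl hlt h0C htorsion (hN _ hγ0)⟩

include hsurj hconv

/-- Connects two points of C by a geodesic, which convexity keeps in C, and retains only real
functions, free of dependent types. The final bound is Cauchy–Schwarz for Df at y. -/
lemma exists_selfConcordantAlong {x y : M} (hx : x ∈ C) (hy : y ∈ C) :
    ∃ (u : TangentSpace 𝓘(ℝ, E) x) (φ φ₁ p : ℝ → ℝ), expMap cov x u = y ∧
      SelfConcordantAlong φ φ₁ p σ ∧
      (∀ t ∈ Icc (0 : ℝ) 1, |√(p (1 - t)) - √(p 1)| ≤ σ * t * (√(p (1 - t)) * √(p 1))) ∧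
      φ 0 = f x ∧ φ 1 = f y ∧ φ₁ 0 = differential f x u ∧ p 0 = hessian cov f x u u ∧
      |φ₁ 1| ≤ newtonDecrement cov f y * √(p 1) := by
  obtain ⟨u, rfl⟩ := hsurj x y
  obtain ⟨γ, hγ, hγ0, hγ1⟩ := isExp_expMap (hexp x u)
  have h0 : γ 0 = x := congrArg (fun p : TangentBundle 𝓘(ℝ, E) M => p.1) hγ0
  have hx' : γ 0 ∈ C := by rwa [h0]
  have hy' : γ 1 ∈ C := by rwa [hγ1]
  have hγC := hconv γ 0 1 zero_lt_one hγ hx' hy'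
  have hφ : ∀ p : TangentBundle 𝓘(ℝ, E) M, p = ⟨x, u⟩ →
      differential f p.1 p.2 = differential f x u ∧
        hessian cov f p.1 p.2 p.2 = hessian cov f x u u := by
    rintro _ rfl
    exact ⟨rfl, rfl⟩
  obtain ⟨h1, h2⟩ := hφ _ hγ0
  have h3 := abs_differential_le hC hf htorsion hy' (velocity γ (Icc 0 1) 1)
  refine ⟨u, fun r => f (γ r), fun r => differential (E := E) f (γ r) (velocity γ (Icc 0 1) r),
    fun r => hessian cov f (γ r) (velocity γ (Icc 0 1) r) (velocity γ (Icc 0 1) r), rfl,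
    selfConcordantAlong cov hsmooth hC hf hγ hγC,
    abs_sqrt_hessian_sub_le_right cov hsmooth hC hf hγ hγC, ?_, ?_, h1, h2, ?_⟩
  · simp only [h0]
  · simp only [hγ1]
  · rw [← hγ1]
    exact h3

/-- With r = √(Hf(u,u)), `sub_ge` and Df(u) ≥ -λr turn f(exp_x u) ≤ f(x) into cσ'r ≤ log(1+σ'r),
which bounds r. The sublevel set is closed as a slice of the epigraph and lies in the image of a
ball under exp_x. -/
lemma isCompact_sublevel {x : M} (hx : x ∈ C) {σ' : ℝ} (hσ' : 0 < σ') (hσσ' : σ ≤ σ')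
    (hlt : σ' * newtonDecrement cov f x < 1) : IsCompact {y | y ∈ C ∧ f y ≤ f x} := by
  obtain ⟨c₀, hc₀, hcoer⟩ := exists_coercive_hessian hC hf hx
  set c := 1 - σ' * newtonDecrement cov f x with hcdef
  have hc : 0 < c := by linarith
  -- From σ'r ≤ 4/c² and c₀‖u‖ ≤ r.
  set R := 4 / c ^ 2 / σ' / c₀
  have hcont : Continuous fun a : E => expMap cov x (ofChart x x a) :=
    (continuous_expMap hsmooth (hexp x)).comp (ofChart x x).continuous
  refine ((isCompact_closedBall (0 : E) R).image hcont).of_isClosed_subset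
    (hf.closed_epigraph.preimage (Continuous.prodMk_left (f x))) ?_
  rintro y ⟨hy, hyx⟩
  obtain ⟨u, φ, φ₁, p, hu, hSC, -, hφ0, hφ1, hφ₁, hp, -⟩ :=
    exists_selfConcordantAlong hC hf htorsion hsmooth hexp hsurj hconv hx hy
  refine ⟨toChart x x u, ?_, (congrArg (expMap cov x)
    (ofChart_toChart (mem_chart_source E x) u)).trans hu⟩
  have h1 := (hSC.mono hσσ').sub_ge hσ'
  have h2 := (abs_le.1 (abs_differential_le hC hf htorsion hx u)).1
  have h3 := hcoer u
  rw [hφ0, hφ1, hφ₁] at h1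
  rw [← hp] at h2 h3
  have hr : 0 ≤ √(p 0) := Real.sqrt_nonneg _
  set r := √(p 0)
  have h4 : c * (σ' * r) ≤ Real.log (1 + σ' * r) := by
    have h5 : r / σ' - newtonDecrement cov f x * r ≤ Real.log (1 + σ' * r) / σ' ^ 2 := by linarith
    rw [le_div_iff₀ (by positivity)] at h5
    have h6 : (r / σ' - newtonDecrement cov f x * r) * σ' ^ 2 = c * (σ' * r) := by
      rw [hcdef]
      field_simp
    linarith
  have h5 := le_of_mul_le_log hc (by positivity) h4
  rw [mem_closedBall_zero_iff, le_div_iff₀ hc₀, le_div_iff₀ hσ']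
  nlinarith

omit htorsion hsmooth hexp hsurj hconv in
lemma differential_eq_zero_of_isMin {z : M} (hz : z ∈ C) (hmin : ∀ y ∈ C, f z ≤ f y)
    (v : TangentSpace 𝓘(ℝ, E) z) : differential f z v = 0 := by
  have hs := mem_chart_source E z
  have h : IsLocalMin (inChart f z) (extChartAt 𝓘(ℝ, E) z z) := by
    have hcont := continuousAt_extChartAt_symm'' (I := 𝓘(ℝ, E)) (extChartAt_mem_target hs)
    rw [ContinuousAt, extChartAt_left_inv hs] at hcont
    filter_upwards [hcont.eventually (hC.mem_nhds hz)] with a ha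
    rw [inChart, extChartAt_left_inv hs]
    exact hmin _ ha
  rw [differential_eq hC hf.smooth hs hz, h.fderiv_eq_zero]
  rfl

/-- Since Df vanishes at z, `sub_ge` leaves r/σ' - log(1+σ'r)/σ'², which is positive for r > 0. The
choice σ' = σ + 1 also covers σ = 0. -/
lemma lt_of_isMin {z y : M} (hz : z ∈ C) (hmin : ∀ y ∈ C, f z ≤ f y) (hy : y ∈ C) (hne : y ≠ z) :
    f z < f y := by
  obtain ⟨u, φ, φ₁, p, hu, hSC, -, hφ0, hφ1, hφ₁, hp, -⟩ :=
    exists_selfConcordantAlong hC hf htorsion hsmooth hexp hsurj hconv hz hy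
  have hu0 : u ≠ 0 := by
    rintro rfl
    exact hne (by rw [← hu, expMap_zero hsmooth])
  have hσ' : 0 < σ + 1 := by linarith [hf.sigma_nonneg]
  have h1 := (hSC.mono (show σ ≤ σ + 1 by linarith)).sub_ge hσ'
  have hr : 0 < √(p 0) := Real.sqrt_pos.2 (hp ▸ hf.nondegenerate z hz u hu0)
  rw [hφ0, hφ1, hφ₁, differential_eq_zero_of_isMin hC hf hz hmin, zero_add] at h1
  have h2 := Real.log_lt_sub_one_of_pos (show 0 < 1 + (σ + 1) * √(p 0) by positivity)
    (by have := mul_pos hσ' hr; linarith)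
  have h3 : Real.log (1 + (σ + 1) * √(p 0)) / (σ + 1) ^ 2 < √(p 0) / (σ + 1) := by
    rw [div_lt_div_iff₀ (by positivity) hσ']
    nlinarith
  linarith

/-- Let r and ρ be the initial and final speeds of the geodesic from z to x_k, in the Hessian norm.
The reversed gradient bound gives ρ²/(1+σρ) ≤ λ_k ρ, so ρ is small with λ_k; comparing speeds makes
r, and hence the initial vector, small. -/
lemma tendsto_of_newtonDecrement {z : M} (hz : z ∈ C) (hmin : ∀ y ∈ C, f z ≤ f y) {ι : Type*}
    {l : Filter ι} {x : ι → M} (hx : ∀ k, x k ∈ C)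
    (hlim : Tendsto (fun k => newtonDecrement cov f (x k)) l (𝓝 0)) :
    Tendsto x l (𝓝 z) := by
  choose u φ φ₁ p hu hSC hright hφ0 hφ1 hφ₁ hp hφ₁' using fun k =>
    exists_selfConcordantAlong hC hf htorsion hsmooth hexp hsurj hconv hz (hx k)
  obtain ⟨c, hc, hcoer⟩ := exists_coercive_hessian hC hf hz
  have hσ := hf.sigma_nonneg
  have hbound : ∀ᶠ k in l, ‖toChart z z (u k)‖ ≤ 4 / c * newtonDecrement cov f (x k) := by
    have hσlim : Tendsto (fun k => σ * newtonDecrement cov f (x k)) l (𝓝 0) := by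
      simpa using hlim.const_mul σ
    -- With σλ < 1/4 one gets ρ ≤ 2λ, then σρ ≤ 1/2, and r - ρ ≤ σρr yields r ≤ 2ρ ≤ 4λ.
    filter_upwards [hσlim.eventually_lt_const (show (0 : ℝ) < 1 / 4 by norm_num)] with k hk
    have h1 := (hSC k).deriv_sub_ge_right hσ (hright k)
    have h2 := (abs_le.1 ((hSC k).bound 1 (right_mem_Icc.2 zero_le_one))).1
    have h3 := (le_abs_self _).trans (hφ₁' k)
    have h4 := hcoer (u k)
    have hlam := newtonDecrement_nonneg cov hC hf (x k)
    rw [← hp] at h4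
    rw [hφ₁ k, differential_eq_zero_of_isMin hC hf hz hmin, sub_zero] at h1
    have hr : 0 ≤ √(p k 0) := Real.sqrt_nonneg _
    have hρ : 0 ≤ √(p k 1) := Real.sqrt_nonneg _
    set r := √(p k 0)
    set ρ := √(p k 1)
    set lam := newtonDecrement cov f (x k)
    have h5 : ρ ≤ 2 * lam := by
      rcases hρ.eq_or_lt with h | h
      · rw [← h]
        positivity
      · have h6 := h1.trans h3
        rw [div_le_iff₀ (by positivity)] at h6
        have h7 : ρ * ρ ≤ ρ * (lam * (1 + σ * ρ)) := by linarith
        have h8 := le_of_mul_le_mul_left h7 h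
        nlinarith
    have h6 : r ≤ 4 * lam := by
      have h7 : σ * ρ ≤ σ * (2 * lam) := mul_le_mul_of_nonneg_left h5 hσ
      have h8 : σ * ρ * r ≤ 1 / 2 * r := mul_le_mul_of_nonneg_right (by linarith) hr
      linarith
    rw [div_mul_eq_mul_div, le_div_iff₀ hc]
    linarith
  have hzero : Tendsto (fun k => toChart z z (u k)) l (𝓝 0) :=
    squeeze_zero_norm' hbound (by simpa using hlim.const_mul (4 / c))
  have hcont : Continuous fun a : E => expMap cov z (ofChart z z a) :=
    (continuous_expMap hsmooth (hexp z)).comp (ofChart z z).continuous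
  have h := (hcont.tendsto 0).comp hzero
  rw [map_zero, expMap_zero hsmooth] at h
  refine h.congr fun k => ?_
  rw [Function.comp_apply, ofChart_toChart (mem_chart_source E z), hu]

end NewtonMethod

end SCManifold

end

/-! ### Assembly of the theorem -/

theorem mainTheorem4 {E : Type*} [NormedAddCommGroup E] [NormedSpace ℝ E] [FiniteDimensional ℝ E]
    {M : Type*} [TopologicalSpace M] [T2Space M] [ChartedSpace E M] [IsManifold 𝓘(ℝ, E) ∞ M]
    (cov : CovariantDerivative 𝓘(ℝ, E) E (TangentSpace 𝓘(ℝ, E) : M → Type _))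
    (hsmooth : CovariantDerivative.ContMDiffCovariantDerivative cov ∞)
    (htorsion : ∀ (X Y : (x : M) → TangentSpace 𝓘(ℝ, E) x),
      ContMDiff 𝓘(ℝ, E) 𝓘(ℝ, E).tangent ∞ (fun x => (⟨x, X x⟩ : TangentBundle 𝓘(ℝ, E) M)) →
      ContMDiff 𝓘(ℝ, E) 𝓘(ℝ, E).tangent ∞ (fun x => (⟨x, Y x⟩ : TangentBundle 𝓘(ℝ, E) M)) →
      ∀ x, cov Y x (X x) - cov X x (Y x) = VectorField.mlieBracket 𝓘(ℝ, E) X Y x)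
    (hexp : ∀ (x : M) (u : TangentSpace 𝓘(ℝ, E) x), ∃ y, SCManifold.IsExp cov x u y)
    (hsurj : ∀ x : M, Function.Surjective (SCManifold.expMap cov x))
    (C : Set M) (hCopen : IsOpen C) (hCconv : SCManifold.GeodesicallyConvex cov C)
    (f : M → ℝ) (σ : ℝ) (hf : SCManifold.IsSelfConcordant cov C f σ) :
    (∀ x ∈ C, σ * SCManifold.newtonDecrement cov f x < 1 →
      SCManifold.newtonStep cov f x ∈ C ∧
      SCManifold.newtonDecrement cov f (SCManifold.newtonStep cov f x) ≤
        σ * SCManifold.newtonDecrement cov f x ^ 2 /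
          (1 - σ * SCManifold.newtonDecrement cov f x) ^ 2) ∧
    (∀ x ∈ C, σ * SCManifold.newtonDecrement cov f x < (3 - √5) / 2 →
      (∀ k : ℕ, (SCManifold.newtonStep cov f)^[k] x ∈ C) ∧
      (∀ k : ℕ, SCManifold.newtonDecrement cov f ((SCManifold.newtonStep cov f)^[k + 1] x) ≤
        σ / (1 - σ * SCManifold.newtonDecrement cov f x) ^ 2 *
          SCManifold.newtonDecrement cov f ((SCManifold.newtonStep cov f)^[k] x) ^ 2) ∧
      Tendsto (fun k : ℕ => SCManifold.newtonDecrement cov f ((SCManifold.newtonStep cov f)^[k] x))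
        atTop (𝓝 0) ∧
      ∃ z ∈ C, (∀ y ∈ C, y ≠ z → f z < f y) ∧
        Tendsto (fun k : ℕ => (SCManifold.newtonStep cov f)^[k] x) atTop (𝓝 z)) := by
  have hpart1 := fun x (hx : x ∈ C) => SCManifold.newtonStep_mem_and_newtonDecrement_le hCopen hf
    htorsion hsmooth hexp hx
  refine ⟨hpart1, fun x hx hlt => ?_⟩
  have hσ := hf.sigma_nonneg
  obtain ⟨hlt1, hθ⟩ := SCManifold.div_one_sub_sq_lt_one hlt
  have hnn := fun y => SCManifold.newtonDecrement_nonneg cov hCopen hf y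
  set lam := SCManifold.newtonDecrement cov f
  set step := SCManifold.newtonStep cov f
  -- The constant is frozen at x: a smaller decrement at y only enlarges 1 - σλ(y), so the estimate
  -- with x's constant holds and the decrement stays at most λ(x).
  have hone : ∀ y ∈ C, lam y ≤ lam x → step y ∈ C ∧
      lam (step y) ≤ σ / (1 - σ * lam x) ^ 2 * lam y ^ 2 ∧ lam (step y) ≤ lam x := by
    intro y hy hyx
    have hσy : σ * lam y ≤ σ * lam x := mul_le_mul_of_nonneg_left hyx hσ
    obtain ⟨h1, h2⟩ := hpart1 y hy (hσy.trans_lt hlt1)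
    have hpos : 0 < 1 - σ * lam x := by linarith
    have h3 : lam (step y) ≤ σ / (1 - σ * lam x) ^ 2 * lam y ^ 2 := by
      refine h2.trans ?_
      rw [div_mul_eq_mul_div]
      have := hnn y
      gcongr
    refine ⟨h1, h3, h3.trans ?_⟩
    calc σ / (1 - σ * lam x) ^ 2 * lam y ^ 2 ≤ σ / (1 - σ * lam x) ^ 2 * lam x ^ 2 := by
          have := hnn y
          gcongr
      _ = σ * lam x / (1 - σ * lam x) ^ 2 * lam x := by ring
      _ ≤ 1 * lam x := mul_le_mul_of_nonneg_right hθ.le (hnn x)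
      _ = lam x := one_mul _
  have hiter : ∀ k : ℕ, step^[k] x ∈ C ∧ lam (step^[k] x) ≤ lam x := by
    intro k
    induction k with
    | zero => exact ⟨hx, le_rfl⟩
    | succ k ih =>
      rw [Function.iterate_succ_apply']
      have h := hone _ ih.1 ih.2
      exact ⟨h.1, h.2.2⟩
  have hquad : ∀ k : ℕ, lam (step^[k + 1] x) ≤
      σ / (1 - σ * lam x) ^ 2 * lam (step^[k] x) ^ 2 := by
    intro k
    rw [Function.iterate_succ_apply']
    exact (hone _ (hiter k).1 (hiter k).2).2.1
  have htend : Tendsto (fun k : ℕ => lam (step^[k] x)) atTop (𝓝 0) :=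
    SCManifold.tendsto_zero_of_newton_rate hσ (fun k => hnn _) hlt (fun k => (hiter k).2) hquad
  refine ⟨fun k => (hiter k).1, hquad, htend, ?_⟩
  -- A strictly positive constant is needed even if σ = 0. The margin 1 - σλ is shared out over λ +
  -- 1, so that σ'λ < 1 persists.
  obtain ⟨σ', hσ', hσσ', hlt'⟩ : ∃ σ' : ℝ, 0 < σ' ∧ σ ≤ σ' ∧ σ' * lam x < 1 := by
    have hpos : 0 < 1 - σ * lam x := by linarith
    have hx1 : 0 < lam x + 1 := by linarith [hnn x]
    refine ⟨σ + (1 - σ * lam x) / (lam x + 1), by positivity, by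
      have := div_pos hpos hx1
      linarith, ?_⟩
    have h1 : (1 - σ * lam x) / (lam x + 1) * lam x < 1 - σ * lam x := by
      rw [div_mul_eq_mul_div, div_lt_iff₀ hx1]
      linarith
    linarith
  have hcompact := SCManifold.isCompact_sublevel hCopen hf htorsion hsmooth hexp hsurj hCconv hx
    hσ' hσσ' hlt'
  obtain ⟨z, hz, hzmin⟩ := hcompact.exists_isMinOn ⟨x, hx, le_rfl⟩
    (hf.smooth.continuousOn.mono fun y hy => hy.1)
  have hmin : ∀ y ∈ C, f z ≤ f y := by
    intro y hy
    rcases le_total (f y) (f x) with h | h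
    · exact hzmin ⟨hy, h⟩
    · exact hz.2.trans h
  exact ⟨z, hz.1, fun y hy hne => SCManifold.lt_of_isMin hCopen hf htorsion hsmooth hexp hsurj
    hCconv hz.1 hmin hy hne, SCManifold.tendsto_of_newtonDecrement hCopen hf htorsion hsmooth hexp
    hsurj hCconv hz.1 hmin (fun k => (hiter k).1) htend⟩
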